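/- Fix constants $M\ge 0$, $\zeta\ge 1$ and $0<\alpha<1/2$. For each $n$ let $d=d_n\ge 1$ and $k=k_n\ge 1$ be integers, and let $(X_1,Y_1),\dots,(X_n,Y_n)$ be i.i.d. with values in $[0,1]^d\times[-M,M]$, where the joint law may depend on $n$ and the features $X_i$ have a density $f$ (also depending on $n$) with $\zeta^{-1}\le f(x)\le\zeta$ for all $x\in[0,1]^d$. *Partitions.* Recursive partitioning starts from the single node $[0,1]^d$ and repeatedly replaces a currently unsplit node $\nu$ by its two children $\nu\cap\{x:x_j\le\tau\}$ and $\nu\cap\{x:x_j>\tau\}$, for some coordinate $j\in\{1,\dots,d\}$ and threshold $\tau\in[0,1]$. A resulting partition $\Lambda$ of $[0,1]^d$ is $\{\alpha,k\}$-valid if it can be generated so that each child node contains at least a fraction $\alpha$ of the data points $X_i$ in its parent node and each terminal node contains at least $k$ of the data points. Let $\mathcal V_{\alpha,k}$ be the (random) set of $\{\alpha,k\}$-valid partitions. For $x\in[0,1]^d$ let $L(x)$ be the element of $\Lambda$ containing $x$, and set $$T_\Lambda(x)=\frac{1}{|\{i:X_i\in L(x)\}|}\sum_{i:\,X_i\in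 L(x)}Y_i,\qquad T^*_\Lambda(x)=\mathbb E[Y\mid X\in L(x)],$$ where in $T^*_\Lambda$ the set $L(x)$ is held fixed and $(X,Y)$ is a new, independent draw from the data-generating law. Assume that $$\lim_{n\to\infty}\frac{\log(n)\,\max\{\log d,\ \log\log n\}}{k}=0 .$$ 1. If moreover $\limsup_{n\to\infty}k/n<1$, then $$\lim_{n\to\infty}\mathbb P\left[\sup_{x\in[0,1]^d,\ \Lambda\in\mathcal V_{\alpha,k}}\left|T_\Lambda(x)-T^*_\Lambda(x)\right|\le 9M\sqrt{\frac{\log(n/k)\,\bigl(\log(dk)+3\log\log n\bigr)}{\log\bigl((1-\alpha)^{-1}\bigr)}}\;\frac1{\sqrt k}\right]=1 .$$ 2. If moreover $\liminf_{n\to\infty}d/n>0$ (with no upper restriction on $k$), then $$\lim_{n\to\infty}\mathbb P\left[\sup_{x\in[0,1]^d,\ \Lambda\in\mathcal V_{\alpha,k}}\left|T_\Lambda(x)-T^*_\Lambda(x)\right|\le 9M\sqrt{\frac{\log(n)\,\log(d)}{\log\bigl((1-\alpha)^{-1}\bigr)}}\;\frac1{\sqrt k}\right]=1 .$$ (Probabilities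 are inner probabilities, i.e. each event contains measurable events of probability tending to one. A supremum over the empty set counts as satisfying the bound.) -/

import Mathlib

open Filter Topology MeasureTheory ProbabilityTheory
open scoped ENNReal

noncomputable section

namespace TreeConcentration

/-- The feature space `[0, 1]^d`. -/
def unitCube (d : ℕ) : Set (Fin d → ℝ) := Set.Icc 0 1

/-- Left child `ν ∩ {x : x_j ≤ τ}` of a node `ν`. -/
def leftChild {d : ℕ} (ν : Set (Fin d → ℝ)) (j : Fin d) (τ : ℝ) : Set (Fin d → ℝ) :=
  ν ∩ {x | x j ≤ τ}

/-- Right child `ν ∩ {x : x_j > τ}` of a node `ν`. -/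
def rightChild {d : ℕ} (ν : Set (Fin d → ℝ)) (j : Fin d) (τ : ℝ) : Set (Fin d → ℝ) :=
  ν ∩ {x | τ < x j}

/-- The indices of the training examples whose features fall in `A`. -/
def indicesIn {n d : ℕ} (x : Fin n → Fin d → ℝ) (A : Set (Fin d → ℝ)) : Finset (Fin n) := by
  classical exact Finset.univ.filter (fun i => x i ∈ A)

/-- The number of training examples in `A`. -/
def count {n d : ℕ} (x : Fin n → Fin d → ℝ) (A : Set (Fin d → ℝ)) : ℕ := (indicesIn x A).card

/-- Partitions generated by recursive partitioning of `[0, 1]^d`, starting from the trivial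
partition and repeatedly splitting a currently unsplit node, where each child contains at least a
fraction `α` of the data points of its parent. -/
inductive IsRecursivePartition {n d : ℕ} (α : ℝ) (x : Fin n → Fin d → ℝ) :
    Set (Set (Fin d → ℝ)) → Prop
  | root : IsRecursivePartition α x {unitCube d}
  | split (Λ : Set (Set (Fin d → ℝ))) (ν : Set (Fin d → ℝ)) (j : Fin d) (τ : ℝ) :
      IsRecursivePartition α x Λ → ν ∈ Λ → τ ∈ Set.Icc (0 : ℝ) 1 →
      α * (count x ν : ℝ) ≤ (count x (leftChild ν j τ) : ℝ) →
      α * (count x ν : ℝ) ≤ (count x (rightChild ν j τ) : ℝ) →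
      IsRecursivePartition α x ((Λ \ {ν}) ∪ {leftChild ν j τ, rightChild ν j τ})

/-- The set of `{α, k}`-valid partitions for the features `x`: each terminal node contains at
least `k` training examples. -/
def validPartitions {n d : ℕ} (α : ℝ) (k : ℕ) (x : Fin n → Fin d → ℝ) :
    Set (Set (Set (Fin d → ℝ))) :=
  {Λ | IsRecursivePartition α x Λ ∧ ∀ L ∈ Λ, k ≤ count x L}

/-- `L(x)`, the element of the partition `Λ` that contains `x`
(see `cell_eq` for the fact that it is that element). -/
def cell {d : ℕ} (Λ : Set (Set (Fin d → ℝ))) (x : Fin d → ℝ) : Set (Fin d → ℝ) :=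
  ⋃₀ {L | L ∈ Λ ∧ x ∈ L}

theorem IsRecursivePartition.existsUnique {n d : ℕ} {α : ℝ} {x : Fin n → Fin d → ℝ}
    {Λ : Set (Set (Fin d → ℝ))} (h : IsRecursivePartition α x Λ) :
    (∀ L ∈ Λ, L ⊆ unitCube d) ∧ ∀ z ∈ unitCube d, ∃! L, L ∈ Λ ∧ z ∈ L := by
  induction h with
  | root =>
    refine ⟨?_, ?_⟩
    · rintro L rfl; exact subset_rfl
    · intro z hz
      exact ⟨unitCube d, ⟨rfl, hz⟩, fun L hL => hL.1⟩
  | split Λ ν j τ _ hν _ _ _ ih =>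
    obtain ⟨hsub, hu⟩ := ih
    refine ⟨?_, ?_⟩
    · rintro L (⟨hL, -⟩ | rfl | rfl)
      · exact hsub L hL
      · exact Set.inter_subset_left.trans (hsub ν hν)
      · exact Set.inter_subset_left.trans (hsub ν hν)
    · intro z hz
      obtain ⟨L, ⟨hL, hzL⟩, huniq⟩ := hu z hz
      have huniq' : ∀ L', L' ∈ Λ → z ∈ L' → L' = L := fun L' h1 h2 => huniq L' ⟨h1, h2⟩
      by_cases hLν : L = ν
      · subst hLν
        rcases le_or_gt (z j) τ with hle | hgt
        · refine ⟨leftChild L j τ, ⟨Or.inr (Or.inl rfl), hzL, hle⟩, ?_⟩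
          rintro L' ⟨(⟨h1, h2⟩ | rfl | rfl), h3⟩
          · exact absurd (huniq' L' h1 h3) h2
          · rfl
          · exact absurd h3.2 (not_lt.mpr hle)
        · refine ⟨rightChild L j τ, ⟨Or.inr (Or.inr rfl), hzL, hgt⟩, ?_⟩
          rintro L' ⟨(⟨h1, h2⟩ | rfl | rfl), h3⟩
          · exact absurd (huniq' L' h1 h3) h2
          · exact absurd h3.2 (not_le.mpr hgt)
          · rfl
      · refine ⟨L, ⟨Or.inl ⟨hL, hLν⟩, hzL⟩, ?_⟩
        rintro L' ⟨(⟨h1, -⟩ | rfl | rfl), h3⟩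
        · exact huniq' L' h1 h3
        · exact absurd (huniq' ν hν h3.1).symm hLν
        · exact absurd (huniq' ν hν h3.1).symm hLν

/-- In a partition produced by recursive partitioning, `cell Λ z` is the unique element of `Λ`
containing `z`. -/
theorem cell_eq {n d : ℕ} {α : ℝ} {x : Fin n → Fin d → ℝ} {Λ : Set (Set (Fin d → ℝ))}
    (h : IsRecursivePartition α x Λ) {L : Set (Fin d → ℝ)} (hL : L ∈ Λ) {z : Fin d → ℝ}
    (hz : z ∈ L) : cell Λ z = L := by
  obtain ⟨hsub, hu⟩ := h.existsUnique
  have hun : ∀ L', L' ∈ Λ → z ∈ L' → L' = L := fun L' h1 h2 =>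
    (hu z (hsub L hL hz)).unique ⟨h1, h2⟩ ⟨hL, hz⟩
  have : {L' | L' ∈ Λ ∧ z ∈ L'} = {L} := by
    ext L'
    exact ⟨fun h' => hun L' h'.1 h'.2, fun h' => by rw [Set.mem_singleton_iff.mp h']; exact ⟨hL, hz⟩⟩
  rw [cell, this, Set.sUnion_singleton]

/-- The valid tree `T_Λ`: the average of the responses over the leaf containing `z`. -/
def tree {n d : ℕ} (x : Fin n → Fin d → ℝ) (y : Fin n → ℝ) (Λ : Set (Set (Fin d → ℝ)))
    (z : Fin d → ℝ) : ℝ :=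
  (∑ i ∈ indicesIn x (cell Λ z), y i) / (count x (cell Λ z) : ℝ)

/-- The partition-optimal tree `T*_Λ(z) = E[Y | X ∈ L(z)]`, for a new pair `(X, Y)` of law `ν`. -/
def optimalTree {d : ℕ} (ν : Measure ((Fin d → ℝ) × ℝ)) (Λ : Set (Set (Fin d → ℝ)))
    (z : Fin d → ℝ) : ℝ :=
  ∫ p, p.2 ∂(ProbabilityTheory.cond ν (Prod.fst ⁻¹' (cell Λ z)))

/-- `μ` is a distribution on `[0, 1]^d` with a density `f` satisfying `ζ⁻¹ ≤ f ≤ ζ`. -/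
def HasBoundedDensity {d : ℕ} (ζ : ℝ) (μ : Measure (Fin d → ℝ)) : Prop :=
  ∃ f : (Fin d → ℝ) → ℝ, Measurable f ∧ (∀ x ∈ unitCube d, ζ⁻¹ ≤ f x ∧ f x ≤ ζ) ∧
    μ = (volume.restrict (unitCube d)).withDensity (fun x => ENNReal.ofReal (f x))

/-- The events `E n` hold with probability tending to one. The inner probability is used, so that
no measurability of `E n` is presupposed; for measurable events see `whp_iff`. -/
def WithHighProbability {Ω : ℕ → Type*} [∀ n, MeasurableSpace (Ω n)]
    (P : ∀ n, Measure (Ω n)) (E : ∀ n, Set (Ω n)) : Prop :=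
  ∃ A : ∀ n, Set (Ω n), (∀ n, MeasurableSet (A n) ∧ A n ⊆ E n) ∧
    Tendsto (fun n => P n (A n)) atTop (𝓝 1)

theorem whp_iff {Ω : ℕ → Type*} [∀ n, MeasurableSpace (Ω n)]
    (P : ∀ n, Measure (Ω n)) [∀ n, IsProbabilityMeasure (P n)] (E : ∀ n, Set (Ω n))
    (hE : ∀ n, MeasurableSet (E n)) :
    WithHighProbability P E ↔ Tendsto (fun n => P n (E n)) atTop (𝓝 1) := by
  constructor
  · rintro ⟨A, hA, hlim⟩
    exact tendsto_of_tendsto_of_tendsto_of_le_of_le hlim tendsto_const_nhds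
      (fun n => measure_mono (hA n).2) (fun n => prob_le_one)
  · intro h
    exact ⟨E, fun n => ⟨hE n, subset_rfl⟩, h⟩

end TreeConcentration

end

namespace TreeConcentration

/-! A leaf reached after `t` splits holds at most `n * (1 - α) ^ t` data points, since the sibling
at each split takes a fraction `α`. As it also holds `k` points, `t` is at most `S = ⌊log (n / k) /
log (1 / (1 - α))⌋`. Hence every leaf is, up to boundary, a box with at most `S` sides other than
`[0, 1]`, and the randomness of the partition is handled by a bound uniform over such boxes.

Boxes of volume at least `w = k / (8 * ζ * n)` are enclosed in a finite, non-random family of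
brackets `A ⊆ L ⊆ B`, where `B \ A` is small relative to `A` (`exists_brackets`). A fixed grid at
scale `w` would cost about `log (n / k)` per side, which is too much. Instead the grid for each side
is relative to its own length `2⁻q`. There are about `m² 2^q` such intervals; weighted by `2⁻q`,
each scale contributes only `m²`. As the product of the sides is at least `w`, a Markov bound on the
weighted sum over words counts the brackets at the price `log (n / k)` paid once instead of once per
side. Boxes of volume below `w` cannot be leaves: a slightly larger box already contains fewer than
`k` points.

On each bracket, Bernstein bounds control the number of points in `A`, `B \ A` and `B`, and the
centred sum of responses over `A`. The average over `L` differs from that over `A` only through `B \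
A`, in the sample and in the law (`abs_tree_sub_optimalTree_le`).

Let `9 * M * √U / √k` be the target. The deviations are taken at level `H = 9 * U` and the number of
brackets is at most `exp (5 * U)`, so the union bound fails with probability at most `5 * exp (-4 *
U)`. It remains to check that `U → ∞`, `U / k → 0` and the entropy is at most `5 * U` in both
regimes (`withHighProbability_abs_tree_sub_le`, `exists_entropy_le`). -/

/-! ### Counting data points in nodes. -/

theorem count_mono {n d : ℕ} (x : Fin n → Fin d → ℝ) {A B : Set (Fin d → ℝ)} (h : A ⊆ B) :
    count x A ≤ count x B := by
  classical
  unfold count indicesIn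
  refine Finset.card_le_card fun i hi => ?_
  simp only [Finset.mem_filter, Finset.mem_univ, true_and] at hi ⊢
  exact h hi

theorem count_le {n d : ℕ} (x : Fin n → Fin d → ℝ) (A : Set (Fin d → ℝ)) : count x A ≤ n := by
  simpa [count] using Finset.card_le_univ (indicesIn x A)

theorem count_leftChild_add_count_rightChild {n d : ℕ} (x : Fin n → Fin d → ℝ)
    (ν : Set (Fin d → ℝ)) (j : Fin d) (τ : ℝ) :
    count x (leftChild ν j τ) + count x (rightChild ν j τ) = count x ν := by
  classical
  unfold count indicesIn
  rw [← Finset.card_union_of_disjoint]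
  · congr 1
    ext i
    simp only [leftChild, rightChild, Finset.mem_union, Finset.mem_filter, Finset.mem_univ,
      true_and, Set.mem_inter_iff, Set.mem_ofPred_eq, ← and_or_left]
    exact and_iff_left (le_or_gt _ _)
  · rw [Finset.disjoint_left]
    intro i hi hi'
    simp only [leftChild, rightChild, Finset.mem_filter, Finset.mem_univ,
      true_and, Set.mem_inter_iff, Set.mem_ofPred_eq] at hi hi'
    exact absurd hi.2 (not_le.2 hi'.2)

/-! ### Leaves are boxes with few nontrivial sides. -/

/-- The coordinates in which the box with corners `a`, `b` differs from the unit cube. -/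
noncomputable def boxSupport {d : ℕ} (a b : Fin d → ℝ) : Finset (Fin d) := by
  classical exact Finset.univ.filter (fun j => a j ≠ 0 ∨ b j ≠ 1)

theorem mem_boxSupport {d : ℕ} {a b : Fin d → ℝ} {j : Fin d} :
    j ∈ boxSupport a b ↔ a j ≠ 0 ∨ b j ≠ 1 := by
  simp [boxSupport]

/-- `a` and `b` are the corners of a subbox of the unit cube. -/
def IsSubbox {d : ℕ} (a b : Fin d → ℝ) : Prop := ∀ j, 0 ≤ a j ∧ a j ≤ b j ∧ b j ≤ 1

theorem card_boxSupport_le {d : ℕ} {a b a' b' : Fin d → ℝ} (j : Fin d)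
    (h : ∀ i, i ≠ j → a' i = a i ∧ b' i = b i) :
    (boxSupport a' b').card ≤ (boxSupport a b).card + 1 := by
  classical
  refine (Finset.card_le_card (t := insert j (boxSupport a b)) fun i hi => ?_).trans
    (Finset.card_insert_le _ _)
  by_cases hij : i = j
  · simp [hij]
  · rw [mem_boxSupport, (h i hij).1, (h i hij).2] at hi
    exact Finset.mem_insert_of_mem (mem_boxSupport.2 hi)

/-- `L` is, up to its boundary, a box with at most `t` sides other than `[0, 1]`. -/
def IsNearBox {d : ℕ} (t : ℕ) (L : Set (Fin d → ℝ)) : Prop :=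
  MeasurableSet L ∧ ∃ a b : Fin d → ℝ, IsSubbox a b ∧
    (Set.univ.pi fun j => Set.Ioc (a j) (b j)) ⊆ L ∧ L ⊆ Set.Icc a b ∧ (boxSupport a b).card ≤ t

theorem isNearBox_unitCube (d : ℕ) : IsNearBox 0 (unitCube d) := by
  refine ⟨measurableSet_Icc, 0, 1, fun j => by simp, fun z hz => ?_, subset_rfl, ?_⟩
  · have := fun j => hz j (Set.mem_univ _)
    exact ⟨fun j => (this j).1.le, fun j => (this j).2⟩
  · simp [boxSupport]

theorem IsNearBox.leftChild {d t : ℕ} {L : Set (Fin d → ℝ)} (h : IsNearBox t L) (j : Fin d)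
    (τ : ℝ) : IsNearBox (t + 1) (leftChild L j τ) := by
  obtain ⟨hm, a, b, hab, h1, h2, h3⟩ := h
  -- The new corner is clamped to `[a j, b j]`, so a threshold outside the node gives a degenerate
  -- box, which is still a subbox.
  refine ⟨hm.inter (measurableSet_le (measurable_pi_apply j) measurable_const), a,
    Function.update b j (max (a j) (min (b j) τ)), ?_, ?_, ?_, ?_⟩
  · intro i
    obtain ⟨h0, h01, h11⟩ := hab i
    by_cases hij : i = j
    · subst hij
      simp only [Function.update_self]
      exact ⟨h0, le_max_left _ _, max_le (h01.trans h11) ((min_le_left _ _).trans h11)⟩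
    · simpa [Function.update_of_ne hij] using hab i
  · intro z hz
    have hz' := fun i => hz i (Set.mem_univ _)
    have hj := hz' j
    simp only [Function.update_self, Set.mem_Ioc, le_max_iff, le_min_iff] at hj
    have hj' := hj.2.resolve_left (not_le.2 hj.1)
    refine ⟨h1 fun i _ => ?_, hj'.2⟩
    by_cases hij : i = j
    · subst hij; exact ⟨hj.1, hj'.1⟩
    · simpa [Function.update_of_ne hij] using hz' i
  · rintro z ⟨hz, hzj⟩
    have := h2 hz
    refine ⟨this.1, fun i => ?_⟩
    by_cases hij : i = j
    · subst hij
      simp only [Function.update_self]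
      exact le_max_of_le_right (le_min (this.2 i) hzj)
    · simpa [Function.update_of_ne hij] using this.2 i
  · refine (card_boxSupport_le j fun i hij => ?_).trans (Nat.succ_le_succ h3)
    simp [Function.update_of_ne hij]

theorem IsNearBox.rightChild {d t : ℕ} {L : Set (Fin d → ℝ)} (h : IsNearBox t L) (j : Fin d)
    (τ : ℝ) : IsNearBox (t + 1) (rightChild L j τ) := by
  obtain ⟨hm, a, b, hab, h1, h2, h3⟩ := h
  refine ⟨hm.inter (measurableSet_lt measurable_const (measurable_pi_apply j)),
    Function.update a j (min (b j) (max (a j) τ)), b, ?_, ?_, ?_, ?_⟩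
  · intro i
    obtain ⟨h0, h01, h11⟩ := hab i
    by_cases hij : i = j
    · subst hij
      simp only [Function.update_self]
      exact ⟨le_min (h0.trans h01) (h0.trans (le_max_left _ _)), min_le_left _ _, h11⟩
    · simpa [Function.update_of_ne hij] using hab i
  · intro z hz
    have hz' := fun i => hz i (Set.mem_univ _)
    have hj := hz' j
    simp only [Function.update_self, Set.mem_Ioc, min_lt_iff, max_lt_iff] at hj
    have hj' := hj.1.resolve_left (not_lt.2 hj.2)
    refine ⟨h1 fun i _ => ?_, hj'.2⟩
    by_cases hij : i = j
    · subst hij; exact ⟨hj'.1, hj.2⟩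
    · simpa [Function.update_of_ne hij] using hz' i
  · rintro z ⟨hz, hzj⟩
    have := h2 hz
    refine ⟨fun i => ?_, this.2⟩
    by_cases hij : i = j
    · subst hij
      simp only [Function.update_self]
      exact min_le_of_right_le (max_le (this.1 i) (le_of_lt hzj))
    · simpa [Function.update_of_ne hij] using this.1 i
  · refine (card_boxSupport_le j fun i hij => ?_).trans (Nat.succ_le_succ h3)
    simp [Function.update_of_ne hij]

/-- One integer `t`, the depth of the leaf, bounds both quantities: a split alters one side and
leaves at most a fraction `1 - α` of the points. -/
theorem IsRecursivePartition.exists_isNearBox {n d : ℕ} {α : ℝ} (hα : α ≤ 1)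
    {x : Fin n → Fin d → ℝ} {Λ : Set (Set (Fin d → ℝ))} (h : IsRecursivePartition α x Λ) :
    ∀ L ∈ Λ, ∃ t : ℕ, IsNearBox t L ∧ (count x L : ℝ) ≤ n * (1 - α) ^ t := by
  induction h with
  | root =>
    rintro L rfl
    refine ⟨0, isNearBox_unitCube d, ?_⟩
    simpa using count_le x (unitCube d)
  | split Λ ν j τ _ hν _ hl hr ih =>
    obtain ⟨t, ht, hc⟩ := ih ν hν
    have hadd : (count x (TreeConcentration.leftChild ν j τ) : ℝ) +
        count x (TreeConcentration.rightChild ν j τ) = count x ν := by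
      exact_mod_cast count_leftChild_add_count_rightChild x ν j τ
    have hstep : (1 - α) * (count x ν : ℝ) ≤ n * (1 - α) ^ (t + 1) := by
      calc (1 - α) * (count x ν : ℝ) ≤ (1 - α) * (n * (1 - α) ^ t) :=
            mul_le_mul_of_nonneg_left hc (by linarith)
        _ = _ := by ring
    rintro L (⟨hL, -⟩ | rfl | rfl)
    · exact ih L hL
    · exact ⟨t + 1, ht.leftChild j τ, by linarith⟩
    · exact ⟨t + 1, ht.rightChild j τ, by linarith⟩

theorem exists_isNearBox_floor {n d k : ℕ} {α : ℝ} (hα : 0 < α) (hα' : α < 1) (hk : 0 < k)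
    {x : Fin n → Fin d → ℝ} {Λ : Set (Set (Fin d → ℝ))} (h : Λ ∈ validPartitions α k x)
    {L : Set (Fin d → ℝ)} (hL : L ∈ Λ) :
    IsNearBox ⌊Real.log ((n : ℝ) / k) / Real.log ((1 - α)⁻¹)⌋₊ L := by
  obtain ⟨t, ⟨hm, a, b, hab, h1, h2, h3⟩, hc⟩ := h.1.exists_isNearBox hα'.le L hL
  refine ⟨hm, a, b, hab, h1, h2, h3.trans (Nat.le_floor ?_)⟩
  have hk' : (0 : ℝ) < k := by exact_mod_cast hk
  have hkn : (k : ℝ) ≤ n * (1 - α) ^ t := le_trans (by exact_mod_cast h.2 L hL) hc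
  have h1α : 0 < 1 - α := by linarith
  have hlog : 0 < Real.log ((1 - α)⁻¹) := Real.log_pos ((one_lt_inv₀ h1α).2 (by linarith))
  rw [le_div_iff₀ hlog, ← Real.log_pow]
  refine Real.log_le_log (by positivity) ?_
  rw [inv_pow, le_div_iff₀ hk', inv_mul_le_iff₀ (by positivity)]
  linarith

/-! ### Brackets for boxes and their number. -/

/-- A generating function bound for the number of words of large weight. -/
theorem card_filter_prod_weight_le {d : ℕ} {C : Type*} [DecidableEq C] (T : Finset C) (wt : C → ℝ)
    (hwt : ∀ c, 0 ≤ wt c) {ε θ : ℝ} (hε : 0 < ε) (hθ : 0 ≤ θ)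
    (hθK : d * (θ * ∑ c ∈ T, wt c) ≤ 1) :
    (((Fintype.piFinset fun _ : Fin d => Finset.insertNone T).filter
      (fun c => ε ≤ ∏ j, (c j).elim 1 (fun x => θ * wt x))).card : ℝ) ≤ Real.exp 1 / ε := by
  set g : Option C → ℝ := fun o => o.elim 1 (fun x => θ * wt x) with hg
  have hg0 : ∀ o, 0 ≤ g o := by
    rintro (_ | x)
    · simp [hg]
    · exact mul_nonneg hθ (hwt x)
  set F := Fintype.piFinset fun _ : Fin d => Finset.insertNone T
  rw [le_div_iff₀ hε]
  -- Markov's inequality for counting measure: the total weight of all words factorizes over the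
  -- coordinates as `(1 + θ * ∑ wt) ^ d`, and `θ` is so small that this is at most `e`.
  calc ((F.filter (fun c => ε ≤ ∏ j, g (c j))).card : ℝ) * ε
      = ∑ _c ∈ F.filter (fun c => ε ≤ ∏ j, g (c j)), ε := by simp
    _ ≤ ∑ c ∈ F.filter (fun c => ε ≤ ∏ j, g (c j)), ∏ j, g (c j) :=
        Finset.sum_le_sum fun c hc => (Finset.mem_filter.1 hc).2
    _ ≤ ∑ c ∈ F, ∏ j, g (c j) :=
        Finset.sum_le_sum_of_subset_of_nonneg (Finset.filter_subset _ _)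
          fun c _ _ => Finset.prod_nonneg fun j _ => hg0 _
    _ = (1 + θ * ∑ c ∈ T, wt c) ^ d := by
        rw [Finset.sum_prod_piFinset (Finset.insertNone T) (fun _ : Fin d => g)]
        simp [hg, Finset.mul_sum]
    _ ≤ Real.exp (θ * ∑ c ∈ T, wt c) ^ d := by
        have : 0 ≤ θ * ∑ c ∈ T, wt c := mul_nonneg hθ (Finset.sum_nonneg fun c _ => hwt c)
        gcongr
        rw [add_comm]; exact Real.add_one_le_exp _
    _ ≤ Real.exp 1 := by
        rw [← Real.exp_nat_mul]; exact Real.exp_le_exp.2 hθK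

/-- Codes `(q, u, r)` for intervals of length about `2⁻q`, with endpoints on the grid of mesh
`2⁻q / m`. -/
def intervalCodes (m Q : ℕ) : Finset (Σ _ : ℕ, ℕ × ℕ) :=
  (Finset.range (Q + 1)).sigma fun q => Finset.range (m * 2 ^ q) ×ˢ Finset.range (m + 2)

/-- The weight `2⁻q` of an interval code. -/
noncomputable def codeWeight (c : Σ _ : ℕ, ℕ × ℕ) : ℝ := (1 / 2) ^ c.1

/-- The mesh of the grid of an interval code. -/
noncomputable def codeMesh (m : ℕ) (c : Σ _ : ℕ, ℕ × ℕ) : ℝ := (1 / 2) ^ c.1 / m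

theorem sum_codeWeight (m Q : ℕ) :
    ∑ c ∈ intervalCodes m Q, codeWeight c = (Q + 1) * (m * (m + 2)) := by
  rw [intervalCodes, Finset.sum_sigma]
  have : ∀ q ∈ Finset.range (Q + 1),
      ∑ s ∈ Finset.range (m * 2 ^ q) ×ˢ Finset.range (m + 2), codeWeight ⟨q, s⟩ =
        (m : ℝ) * (m + 2) := by
    intro q _
    simp only [codeWeight, Finset.sum_const, Finset.card_product, Finset.card_range, nsmul_eq_mul]
    push_cast
    have : (2 : ℝ) ^ q * (1 / 2) ^ q = 1 := by rw [← mul_pow]; norm_num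
    linear_combination (m : ℝ) * (m + 2) * this
  rw [Finset.sum_congr rfl this]
  simp

/-- The scale `q` is that of the interval itself, so the mesh `h = 2⁻q / m` is a fixed fraction of
its length. The outer interval rounds the endpoints outwards to the grid; the inner one is a grid
step shorter at each end. -/
theorem exists_intervalCode {m Q : ℕ} (hm : 0 < m) {a b : ℝ} (ha : 0 ≤ a) (hb : b ≤ 1)
    (hab : a < b) (hQ : (1 / 2 : ℝ) ^ (Q + 1) < b - a) :
    ∃ c ∈ intervalCodes m Q, b - a ≤ codeWeight c ∧
      a ≤ (c.2.1 + 1) * codeMesh m c ∧ (c.2.1 + c.2.2 - 1) * codeMesh m c ≤ b ∧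
      c.2.1 * codeMesh m c ≤ a ∧ b ≤ (c.2.1 + c.2.2) * codeMesh m c ∧
      (1 - 4 / m) * (b - a) ≤
        (c.2.1 + c.2.2 - 1) * codeMesh m c - (c.2.1 + 1) * codeMesh m c ∧
      (c.2.1 + c.2.2) * codeMesh m c - c.2.1 * codeMesh m c ≤ (1 + 4 / m) * (b - a) := by
  obtain ⟨q, hq1, hq2⟩ := exists_nat_pow_near_of_lt_one (y := (1 / 2 : ℝ)) (sub_pos.2 hab)
    (by linarith) (by norm_num) (by norm_num)
  have hm' : (0 : ℝ) < m := by exact_mod_cast hm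
  set h : ℝ := (1 / 2) ^ q / m with hh
  have hh0 : 0 < h := by positivity
  have hmh : m * h = (1 / 2) ^ q := by rw [hh]; field_simp
  set u := ⌊a / h⌋₊
  set v := ⌈b / h⌉₊
  have hu1 : (u : ℝ) * h ≤ a := (le_div_iff₀ hh0).1 (Nat.floor_le (by positivity))
  have hu2 : a < (u + 1) * h := (div_lt_iff₀ hh0).1 (Nat.lt_floor_add_one _)
  have hv1 : b ≤ v * h := (div_le_iff₀ hh0).1 (Nat.le_ceil _)
  have hv2 : (v - 1) * h < b := by
    rw [← lt_div_iff₀ hh0]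
    linarith [Nat.ceil_lt_add_one (a := b / h) (by have := ha.trans hab.le; positivity)]
  have huv : u ≤ v := by
    have : (u : ℝ) < v := lt_of_mul_lt_mul_right (by linarith : (u : ℝ) * h < v * h) hh0.le
    exact_mod_cast this.le
  have hr : ((v - u : ℕ) : ℝ) = v - u := by push_cast [huv]; ring
  -- By the choice of `q`, `b - a > 2⁻q / 2 = m * h / 2`; so two grid steps, the loss in length, are
  -- at most `4 / m` of the length.
  have h4 : 4 / m * (b - a) ≥ 2 * h := by
    rw [ge_iff_le, div_mul_eq_mul_div, le_div_iff₀ hm']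
    rw [pow_succ] at hq1
    linarith
  have hmesh : codeMesh m ⟨q, (u, v - u)⟩ = h := rfl
  refine ⟨⟨q, (u, v - u)⟩, ?_, hq2, ?_⟩
  · simp only [intervalCodes, Finset.mem_sigma, Finset.mem_range, Finset.mem_product]
    refine ⟨?_, ?_, ?_⟩
    · by_contra hcon
      have : (1 / 2 : ℝ) ^ q ≤ (1 / 2) ^ (Q + 1) :=
        pow_le_pow_of_le_one (by norm_num) (by norm_num) (not_lt.1 hcon)
      linarith
    · have h1 : (m : ℝ) * 2 ^ q * h = 1 := by
        have : (2 : ℝ) ^ q * (1 / 2) ^ q = 1 := by rw [← mul_pow]; norm_num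
        rw [mul_right_comm, hmh, mul_comm, this]
      have : (u : ℝ) < m * 2 ^ q :=
        lt_of_mul_lt_mul_right (by linarith : (u : ℝ) * h < m * 2 ^ q * h) hh0.le
      exact_mod_cast this
    · have : ((v - u : ℕ) : ℝ) < m + 2 := by
        rw [hr]
        refine lt_of_mul_lt_mul_right ?_ hh0.le
        linarith
      exact_mod_cast this
  · simp only [hmesh, hr]
    refine ⟨hu2.le, ?_, hu1, ?_, ?_, ?_⟩ <;> linarith

/-- Bernoulli's inequality: only the at most `S` factors in `t` lose anything, so the dimension does
not enter. -/
theorem one_sub_mul_prod_le {ι : Type*} (s : Finset ι) {f g : ι → ℝ} {ε : ℝ} {S : ℕ}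
    (hε : 0 ≤ ε) (hε1 : ε ≤ 1) {t : Finset ι} (hts : t ⊆ s) (ht : t.card ≤ S)
    (hf : ∀ i ∈ s, 0 ≤ f i) (hfg : ∀ i ∈ s, i ∉ t → f i ≤ g i)
    (hfg' : ∀ i ∈ t, (1 - ε) * f i ≤ g i) :
    (1 - S * ε) * ∏ i ∈ s, f i ≤ ∏ i ∈ s, g i := by
  classical
  calc (1 - S * ε) * ∏ i ∈ s, f i ≤ (1 - ε) ^ t.card * ∏ i ∈ s, f i := by
        have h0 : 0 ≤ ∏ i ∈ s, f i := Finset.prod_nonneg hf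
        refine mul_le_mul_of_nonneg_right ?_ h0
        have h1 := one_add_mul_le_pow (a := -ε) (by linarith) t.card
        have h2 : (t.card : ℝ) * ε ≤ S * ε := by gcongr
        rw [← sub_eq_add_neg] at h1
        linarith
    _ = ∏ i ∈ s, ((if i ∈ t then (1 - ε) else 1) * f i) := by
        rw [Finset.prod_mul_distrib, Finset.prod_ite_mem, Finset.inter_eq_right.2 hts]
        simp
    _ ≤ ∏ i ∈ s, g i := by
        refine Finset.prod_le_prod (fun i hi => ?_) fun i hi => ?_
        · refine mul_nonneg ?_ (hf i hi)
          split_ifs <;> linarith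
        · split_ifs with hit
          · exact hfg' i hit
          · rw [one_mul]; exact hfg i hi hit

theorem prod_le_one_add_mul {ι : Type*} (s : Finset ι) {f g : ι → ℝ} {ε : ℝ} {S : ℕ}
    (hε : 0 ≤ ε) (hε1 : S * ε ≤ 1) {t : Finset ι} (hts : t ⊆ s) (ht : t.card ≤ S)
    (hf : ∀ i ∈ s, 0 ≤ f i) (hg : ∀ i ∈ s, 0 ≤ g i) (hfg : ∀ i ∈ s, i ∉ t → g i ≤ f i)
    (hfg' : ∀ i ∈ t, g i ≤ (1 + ε) * f i) :
    ∏ i ∈ s, g i ≤ (1 + 2 * (S * ε)) * ∏ i ∈ s, f i := by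
  classical
  calc ∏ i ∈ s, g i ≤ ∏ i ∈ s, ((if i ∈ t then (1 + ε) else 1) * f i) := by
        refine Finset.prod_le_prod hg fun i hi => ?_
        split_ifs with hit
        · exact hfg' i hit
        · rw [one_mul]; exact hfg i hi hit
    _ = (1 + ε) ^ t.card * ∏ i ∈ s, f i := by
        rw [Finset.prod_mul_distrib, Finset.prod_ite_mem, Finset.inter_eq_right.2 hts]
        simp
    _ ≤ _ := by
        have h0 : 0 ≤ ∏ i ∈ s, f i := Finset.prod_nonneg hf
        refine mul_le_mul_of_nonneg_right ?_ h0
        have hx0 : 0 ≤ S * ε := by positivity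
        calc (1 + ε) ^ t.card ≤ (1 + ε) ^ S := pow_le_pow_right₀ (by linarith) ht
          _ ≤ Real.exp ε ^ S := by
              gcongr; rw [add_comm]; exact Real.add_one_le_exp _
          _ = Real.exp (S * ε) := by rw [← Real.exp_nat_mul]
          _ ≤ 1 + S * ε + (S * ε) ^ 2 := by
              have := (abs_le.1 (Real.abs_exp_sub_one_sub_id_le (x := S * ε)
                (by rwa [abs_of_nonneg hx0]))).2
              linarith
          _ ≤ _ := by nlinarith

/-- Lower corner of the inner box of a word of interval codes. -/
noncomputable def innerLo {d : ℕ} (m : ℕ) (c : Fin d → Option (Σ _ : ℕ, ℕ × ℕ)) (j : Fin d) : ℝ :=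
  (c j).elim 0 fun x => (x.2.1 + 1) * codeMesh m x

/-- Upper corner of the inner box of a word of interval codes. -/
noncomputable def innerHi {d : ℕ} (m : ℕ) (c : Fin d → Option (Σ _ : ℕ, ℕ × ℕ)) (j : Fin d) : ℝ :=
  (c j).elim 1 fun x => (x.2.1 + x.2.2 - 1) * codeMesh m x

/-- Lower corner of the outer box of a word of interval codes. -/
noncomputable def outerLo {d : ℕ} (m : ℕ) (c : Fin d → Option (Σ _ : ℕ, ℕ × ℕ)) (j : Fin d) : ℝ :=
  (c j).elim 0 fun x => x.2.1 * codeMesh m x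

/-- Upper corner of the outer box of a word of interval codes. -/
noncomputable def outerHi {d : ℕ} (m : ℕ) (c : Fin d → Option (Σ _ : ℕ, ℕ × ℕ)) (j : Fin d) : ℝ :=
  (c j).elim 1 fun x => (x.2.1 + x.2.2) * codeMesh m x

/-- The pair of sets `p.1 ⊆ p.2` is a bracket of volume at least `w / 2` and relative size `ε`. -/
structure IsBracket {d : ℕ} (w ε : ℝ) (p : Set (Fin d → ℝ) × Set (Fin d → ℝ)) : Prop where
  measurableSet_fst : MeasurableSet p.1
  measurableSet_snd : MeasurableSet p.2
  subset : p.1 ⊆ p.2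
  subset_unitCube : p.1 ⊆ unitCube d
  volume_ne_top : volume p.2 ≠ ⊤
  le_volume : w / 2 ≤ volume.real p.1
  volume_diff_le : volume.real (p.2 \ p.1) ≤ ε * volume.real p.1

theorem exists_brackets {d S m Q : ℕ} (hd : 0 < d) (hm : 8 * (S + 1) ≤ m) {w : ℝ}
    (hw : 0 < w) (hQ : (1 / 2 : ℝ) ^ (Q + 1) < w) :
    ∃ R : Finset (Set (Fin d → ℝ) × Set (Fin d → ℝ)),
      (R.card : ℝ) ≤ Real.exp 1 * (d * ((Q + 1) * (m * (m + 2)))) ^ S / w ∧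
      (∀ p ∈ R, IsBracket w (24 * S / m) p) ∧
      ∀ a b : Fin d → ℝ, IsSubbox a b → (boxSupport a b).card ≤ S → w ≤ ∏ j, (b j - a j) →
        ∃ p ∈ R, p.1 ⊆ Set.univ.pi (fun j => Set.Ioc (a j) (b j)) ∧ Set.Icc a b ⊆ p.2 ∧
          volume.real p.2 ≤ 2 * ∏ j, (b j - a j) := by
  classical
  have hm0 : 0 < m := by omega
  have hm' : (8 * (S + 1) : ℝ) ≤ m := by exact_mod_cast hm
  have hmpos : (0 : ℝ) < m := by exact_mod_cast hm0
  have hd' : (1 : ℝ) ≤ d := by exact_mod_cast hd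
  set K : ℝ := (Q + 1) * (m * (m + 2)) with hK
  have hS0 : (0 : ℝ) ≤ S := Nat.cast_nonneg S
  have hQ0 : (0 : ℝ) ≤ Q := Nat.cast_nonneg Q
  have hm8 : (8 : ℝ) ≤ m := by linarith
  have hK1 : 1 ≤ K := one_le_mul_of_one_le_of_one_le (by linarith)
    (one_le_mul_of_one_le_of_one_le (by linarith) (by linarith))
  have hdK : 0 < d * K := by positivity
  -- `d * K` is the total weight of all codes over all coordinates, so this is the largest `θ` that
  -- the counting lemma allows. A word with at most `S` codes pays at most the factor `θ ^ S`.
  set θ : ℝ := (d * K)⁻¹ with hθ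
  have hθ0 : 0 < θ := inv_pos.2 hdK
  set F := (Fintype.piFinset fun _ : Fin d => Finset.insertNone (intervalCodes m Q)).filter
      (fun c => w * θ ^ S ≤ ∏ j, (c j).elim 1 (fun x => θ * codeWeight x)) with hF
  let pr : (Fin d → Option (Σ _ : ℕ, ℕ × ℕ)) → Set (Fin d → ℝ) × Set (Fin d → ℝ) := fun c =>
    (Set.univ.pi fun j => Set.Ioc (innerLo m c j) (innerHi m c j),
      Set.Icc (outerLo m c) (outerHi m c))
  refine ⟨(F.image pr).filter (IsBracket w (24 * S / m)), ?_, ?_, ?_⟩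
  · have h1 : (F.card : ℝ) ≤ Real.exp 1 / (w * θ ^ S) := by
      refine card_filter_prod_weight_le (intervalCodes m Q) codeWeight
        (fun c => by unfold codeWeight; positivity) (by positivity) hθ0.le ?_
      rw [sum_codeWeight, ← hK, hθ]
      have : (d : ℝ) * ((d * K)⁻¹ * K) = 1 := by field_simp
      exact this.le
    have h2 : Real.exp 1 / (w * θ ^ S) = Real.exp 1 * (d * K) ^ S / w := by
      rw [hθ, inv_pow]; field_simp
    rw [← h2]
    refine le_trans ?_ h1
    exact_mod_cast (Finset.card_filter_le _ _).trans Finset.card_image_le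
  · intro p hp
    exact (Finset.mem_filter.1 hp).2
  · intro a b hab hsupp hV
    set V := ∏ j, (b j - a j) with hVdef
    have hVpos : 0 < V := hw.trans_le hV
    have hl0 : ∀ j, 0 ≤ b j - a j := fun j => sub_nonneg.2 (hab j).2.1
    have hl1 : ∀ j, b j - a j ≤ 1 := fun j => by linarith [(hab j).1, (hab j).2.2]
    -- The other sides are at most 1, so each side is at least the whole volume; hence only the
    -- scales `q ≤ Q` occur.
    have hlV : ∀ j, V ≤ b j - a j := fun j => by
      rw [hVdef, ← Finset.mul_prod_erase _ _ (Finset.mem_univ j)]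
      exact mul_le_of_le_one_right (hl0 j) (Finset.prod_le_one (fun i _ => hl0 i) fun i _ => hl1 i)
    have hlt : ∀ j, a j < b j := fun j => by linarith [hlV j]
    choose x hxmem hxw hx1 hx2 hx3 hx4 hx5 hx6 using fun j =>
      exists_intervalCode hm0 (hab j).1 (hab j).2.2 (hlt j)
        (hQ.trans_le (hV.trans (hlV j)))
    let c : Fin d → Option (Σ _ : ℕ, ℕ × ℕ) :=
      fun j => if j ∈ boxSupport a b then some (x j) else none
    have hin : ∀ j, j ∈ boxSupport a b → c j = some (x j) := fun j hj => if_pos hj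
    have hout : ∀ j, j ∉ boxSupport a b → c j = none := fun j hj => if_neg hj
    have hnot : ∀ j, j ∉ boxSupport a b → a j = 0 ∧ b j = 1 := fun j hj => by
      rw [mem_boxSupport] at hj; push Not at hj; exact hj
    have hprop : ∀ j, a j ≤ innerLo m c j ∧ innerHi m c j ≤ b j ∧ outerLo m c j ≤ a j ∧
        b j ≤ outerHi m c j := by
      intro j
      unfold innerLo innerHi outerLo outerHi
      by_cases hj : j ∈ boxSupport a b
      · rw [hin j hj]
        exact ⟨hx1 j, hx2 j, hx3 j, hx4 j⟩
      · rw [hout j hj, (hnot j hj).1, (hnot j hj).2]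
        simp
    have hcF : c ∈ F := by
      rw [hF, Finset.mem_filter, Fintype.mem_piFinset]
      refine ⟨fun j => ?_, ?_⟩
      · by_cases hj : j ∈ boxSupport a b
        · rw [hin j hj]; exact Finset.some_mem_insertNone.2 (hxmem j)
        · rw [hout j hj]; exact Finset.none_mem_insertNone
      · have hθ1 : θ ≤ 1 := by
          rw [hθ]; exact inv_le_one_of_one_le₀ (one_le_mul_of_one_le_of_one_le hd' hK1)
        calc w * θ ^ S ≤ V * θ ^ (boxSupport a b).card :=
              mul_le_mul hV (pow_le_pow_of_le_one hθ0.le hθ1 hsupp) (by positivity) hVpos.le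
          _ = ∏ j, ((if j ∈ boxSupport a b then θ else 1) * (b j - a j)) := by
              rw [Finset.prod_mul_distrib, Finset.prod_ite_mem, Finset.univ_inter,
                Finset.prod_const, mul_comm]
          _ ≤ _ := by
              refine Finset.prod_le_prod (fun j _ => ?_) fun j _ => ?_
              · refine mul_nonneg ?_ (hl0 j)
                split_ifs <;> [exact hθ0.le; exact zero_le_one]
              · by_cases hj : j ∈ boxSupport a b
                · rw [hin j hj, if_pos hj]
                  exact mul_le_mul_of_nonneg_left (hxw j) hθ0.le
                · rw [hout j hj, if_neg hj]
                  simpa using hl1 j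
    have hS4 : (S : ℝ) * (4 / m) ≤ 1 / 2 := by
      rw [mul_div_assoc', div_le_iff₀ hmpos]; linarith
    have h4m : 4 / (m : ℝ) ≤ 1 := by rw [div_le_iff₀ hmpos]; linarith
    have h4m' : 4 / (m : ℝ) ≤ 1 / 2 := by rw [div_le_iff₀ hmpos]; linarith
    have hinner0 : ∀ j, innerLo m c j ≤ innerHi m c j := by
      intro j
      unfold innerLo innerHi
      by_cases hj : j ∈ boxSupport a b
      · rw [hin j hj]
        have h1 := hx5 j
        have h2 : 0 ≤ (1 - 4 / (m : ℝ)) * (b j - a j) := mul_nonneg (by linarith) (hl0 j)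
        simp only [Option.elim_some]
        linarith
      · rw [hout j hj]; simp
    have hvol1 : volume.real (pr c).1 = ∏ j, (innerHi m c j - innerLo m c j) := by
      rw [measureReal_def, Real.volume_pi_Ioc_toReal hinner0]
    have hvol2 : volume.real (pr c).2 = ∏ j, (outerHi m c j - outerLo m c j) := by
      rw [measureReal_def, Real.volume_Icc_pi_toReal]
      exact fun j => by have := hprop j; linarith [hlt j]
    have hV1 : (1 - S * (4 / m)) * V ≤ volume.real (pr c).1 := by
      rw [hvol1]
      refine one_sub_mul_prod_le _ (by positivity) h4m (Finset.subset_univ (boxSupport a b)) hsupp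
        (fun j _ => hl0 j) (fun j _ hj => ?_) fun j hj => ?_
      · unfold innerLo innerHi
        rw [hout j hj, (hnot j hj).1, (hnot j hj).2]; simp
      · unfold innerLo innerHi
        rw [hin j hj]; exact hx5 j
    have hV2 : volume.real (pr c).2 ≤ (1 + 2 * (S * (4 / m))) * V := by
      rw [hvol2]
      refine prod_le_one_add_mul _ (by positivity) (by linarith)
        (Finset.subset_univ (boxSupport a b)) hsupp (fun j _ => hl0 j)
        (fun j _ => by have := hprop j; linarith [hlt j]) (fun j _ hj => ?_) fun j hj => ?_
      · unfold outerLo outerHi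
        rw [hout j hj, (hnot j hj).1, (hnot j hj).2]; simp
      · unfold outerLo outerHi
        rw [hin j hj]; exact hx6 j
    have hsub1 : (pr c).1 ⊆ Set.univ.pi (fun j => Set.Ioc (a j) (b j)) :=
      Set.pi_mono fun j _ => Set.Ioc_subset_Ioc (hprop j).1 (hprop j).2.1
    have hsub2 : Set.Icc a b ⊆ (pr c).2 :=
      Set.Icc_subset_Icc (fun j => (hprop j).2.2.1) fun j => (hprop j).2.2.2
    have hsub3 : Set.univ.pi (fun j => Set.Ioc (a j) (b j)) ⊆ Set.Icc a b := by
      rw [← Set.pi_univ_Icc]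
      exact Set.pi_mono fun j _ => Set.Ioc_subset_Icc_self
    have hmeas1 : MeasurableSet (pr c).1 := .univ_pi fun j => measurableSet_Ioc
    have hfin : volume (pr c).2 ≠ ⊤ := isCompact_Icc.measure_lt_top.ne
    have hsub : (pr c).1 ⊆ (pr c).2 := hsub1.trans (hsub3.trans hsub2)
    have hVhalf : V / 2 ≤ volume.real (pr c).1 := by nlinarith
    have hbr : IsBracket w (24 * S / m) (pr c) := by
      refine ⟨hmeas1, measurableSet_Icc, hsub, ?_, hfin, by linarith, ?_⟩
      · refine hsub1.trans (hsub3.trans (Set.Icc_subset_Icc (fun j => (hab j).1)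
          fun j => (hab j).2.2))
      · rw [measureReal_sdiff hsub hmeas1 hfin]
        -- With `x = S * (4 / m) ≤ 1 / 2`, outer minus inner volume is at most `3 * x * V`, and `V`
        -- is at most twice the inner volume.
        have e : 24 * S / (m : ℝ) = 6 * (S * (4 / m)) := by ring
        rw [e]
        have h0 : 0 ≤ (S : ℝ) * (4 / m) := by positivity
        nlinarith
    refine ⟨pr c, Finset.mem_filter.2 ⟨Finset.mem_image_of_mem _ hcF, hbr⟩, hsub1, hsub2, ?_⟩
    nlinarith

/-- The box is deformed linearly into the unit cube and the volume takes the value `w` on the way.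
Sides equal to `[0, 1]` stay fixed, so the support does not grow. -/
theorem exists_superbox {d : ℕ} {a b : Fin d → ℝ} (hab : IsSubbox a b) {w : ℝ}
    (hV : ∏ j, (b j - a j) ≤ w) (hw : w ≤ 1) :
    ∃ a' b' : Fin d → ℝ, IsSubbox a' b' ∧ (boxSupport a' b').card ≤ (boxSupport a b).card ∧
      Set.Icc a b ⊆ Set.Icc a' b' ∧ ∏ j, (b' j - a' j) = w := by
  obtain ⟨t, ht, htw⟩ : ∃ t ∈ Set.Icc (0 : ℝ) 1,
      ∏ j, (((1 - t) * b j + t) - (1 - t) * a j) = w := by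
    have hc : ContinuousOn (fun t : ℝ => ∏ j, (((1 - t) * b j + t) - (1 - t) * a j))
        (Set.Icc 0 1) := by fun_prop
    exact intermediate_value_Icc zero_le_one hc (by simpa using ⟨hV, hw⟩)
  refine ⟨fun j => (1 - t) * a j, fun j => (1 - t) * b j + t, fun j => ?_, ?_, ?_, htw⟩
  · obtain ⟨h1, h2, h3⟩ := hab j
    have ht' : 0 ≤ 1 - t := by linarith [ht.2]
    exact ⟨mul_nonneg ht' h1, by nlinarith [ht.1], by nlinarith⟩
  · refine Finset.card_le_card fun j hj => ?_
    rw [mem_boxSupport] at hj ⊢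
    by_contra hcon
    push Not at hcon
    simp [hcon.1, hcon.2] at hj
  · refine Set.Icc_subset_Icc (fun j => ?_) fun j => ?_
    · obtain ⟨h1, h2, h3⟩ := hab j
      show (1 - t) * a j ≤ a j
      nlinarith [ht.1]
    · obtain ⟨h1, h2, h3⟩ := hab j
      show b j ≤ (1 - t) * b j + t
      nlinarith [ht.1]

/-! ### Conditional means and Bernstein bounds. -/

theorem measureReal_mul_integral_cond {E : Type*} [MeasurableSpace E] {ν : Measure E}
    {A : Set E} (hp : 0 < ν.real A)
    (f : E → ℝ) : ν.real A * ∫ z, f z ∂(ν[|A]) = ∫ z in A, f z ∂ν := by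
  rw [ProbabilityTheory.cond, integral_smul_measure, ENNReal.toReal_inv, ← measureReal_def,
    smul_eq_mul, mul_inv_cancel_left₀ hp.ne']

section Bernstein

variable {Ω E : Type*} [MeasurableSpace Ω] [MeasurableSpace E] {P : Measure Ω}
  [IsProbabilityMeasure P] {ν : Measure E} [IsProbabilityMeasure ν] {n : ℕ} {W : Fin n → Ω → E}

/-- Integrate `exp x ≤ 1 + x + x ^ 2`, valid for `|x| ≤ 1`; the linear term vanishes. -/
theorem mgf_le_exp_of_abs_le {g : E → ℝ} (hg : Measurable g) {b v s : ℝ}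
    (hb : ∀ᵐ z ∂ν, |g z| ≤ b) (hmean : ∫ z, g z ∂ν = 0) (hv : ∫ z, g z ^ 2 ∂ν ≤ v)
    (hs : 0 ≤ s) (hsb : s * b ≤ 1) : mgf g ν s ≤ Real.exp (s ^ 2 * v) := by
  have hgi : Integrable g ν := .of_bound hg.aestronglyMeasurable b hb
  have hgi2 : Integrable (fun z => g z ^ 2) ν := by
    refine .of_bound (hg.pow_const 2).aestronglyMeasurable (b ^ 2) ?_
    filter_upwards [hb] with z hz
    simpa using pow_le_pow_left₀ (abs_nonneg _) hz 2
  have hle : ∀ᵐ z ∂ν, Real.exp (s * g z) ≤ 1 + s * g z + s ^ 2 * g z ^ 2 := by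
    filter_upwards [hb] with z hz
    have h1 : |s * g z| ≤ 1 := by
      rw [abs_mul, abs_of_nonneg hs]
      exact (mul_le_mul_of_nonneg_left hz hs).trans hsb
    have := (abs_le.1 (Real.abs_exp_sub_one_sub_id_le h1)).2
    rw [mul_pow] at this
    linarith
  calc mgf g ν s ≤ ∫ z, (1 + s * g z + s ^ 2 * g z ^ 2) ∂ν := by
        refine integral_mono_ae ?_ (by fun_prop) hle
        refine .of_bound (by fun_prop) (Real.exp 1) ?_
        filter_upwards [hb] with z hz
        rw [Real.norm_of_nonneg (Real.exp_pos _).le]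
        exact Real.exp_le_exp.2 (((mul_le_mul_of_nonneg_left
          ((le_abs_self _).trans hz) hs)).trans hsb)
    _ = 1 + s ^ 2 * ∫ z, g z ^ 2 ∂ν := by
        rw [integral_add (by fun_prop) (by fun_prop), integral_add (by fun_prop) (by fun_prop),
          integral_const_mul, integral_const_mul, hmean]
        simp
    _ ≤ 1 + s ^ 2 * v := by gcongr
    _ ≤ _ := by rw [add_comm]; exact Real.add_one_le_exp _

theorem measure_le_sum_le_exp (hW : ∀ i, HasLaw (W i) ν P) (hind : iIndepFun W P) {g : E → ℝ}
    (hg : Measurable g) {b v s : ℝ} (t : ℝ)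
    (hb : ∀ᵐ z ∂ν, |g z| ≤ b) (hmean : ∫ z, g z ∂ν = 0) (hv : ∫ z, g z ^ 2 ∂ν ≤ v)
    (hs : 0 ≤ s) (hsb : s * b ≤ 1) :
    P {ω | t ≤ ∑ i, g (W i ω)} ≤ ENNReal.ofReal (Real.exp (-s * t + n * (s ^ 2 * v))) := by
  have hWm : ∀ i, AEMeasurable (fun ω => g (W i ω)) P :=
    fun i => hg.comp_aemeasurable (hW i).aemeasurable
  have hbW : ∀ᵐ ω ∂P, ∀ i, |g (W i ω)| ≤ b := by
    rw [ae_all_iff]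
    intro i
    have h := hb
    rw [← (hW i).map_eq] at h
    exact ae_of_ae_map (hW i).aemeasurable h
  have hsum : mgf (fun ω => ∑ i, g (W i ω)) P s ≤ Real.exp (n * (s ^ 2 * v)) := by
    have h1 := (hind.comp (fun _ => g) (fun _ => hg)).mgf_sum₀ (t := s) hWm Finset.univ
    have h2 : (∑ i, (fun _ : Fin n => g) i ∘ W i) = fun ω => ∑ i, g (W i ω) := by
      ext ω; simp
    rw [← h2, h1, Real.exp_nat_mul]
    calc _ ≤ ∏ _i : Fin n, Real.exp (s ^ 2 * v) := by
          refine Finset.prod_le_prod (fun i _ => mgf_nonneg) fun i _ => ?_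
          have h3 : mgf (g ∘ W i) P s = mgf g ν s := by
            rw [mgf, mgf]
            exact (hW i).integral_comp (f := fun z => Real.exp (s * g z))
              (by fun_prop)
          rw [h3]
          exact mgf_le_exp_of_abs_le hg hb hmean hv hs hsb
      _ = _ := by simp
  have hint : Integrable (fun ω => Real.exp (s * ∑ i, g (W i ω))) P := by
    have hm : AEMeasurable (fun ω => ∑ i, g (W i ω)) P :=
      Finset.aemeasurable_fun_sum _ fun i _ => hWm i
    refine .of_bound (Real.measurable_exp.comp_aemeasurable
      (hm.const_mul s)).aestronglyMeasurable (Real.exp (s * (n * b))) ?_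
    filter_upwards [hbW] with ω hω
    rw [Real.norm_of_nonneg (Real.exp_pos _).le]
    refine Real.exp_le_exp.2 (mul_le_mul_of_nonneg_left ?_ hs)
    calc ∑ i, g (W i ω) ≤ ∑ _i : Fin n, b :=
          Finset.sum_le_sum fun i _ => (le_abs_self _).trans (hω i)
      _ = _ := by simp
  have h4 := measure_ge_le_exp_mul_mgf (μ := P) (X := fun ω => ∑ i, g (W i ω)) t hs hint
  rw [← ofReal_measureReal]
  refine ENNReal.ofReal_le_ofReal (h4.trans ?_)
  rw [Real.exp_add]
  gcongr

/-- The exponent is `-2 * H + H` at `s = √(H / (n * v))`. The condition `H * b ^ 2 ≤ n * v` says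
that this `s` is admissible, so no linear Bernstein term appears. -/
theorem measure_two_mul_sqrt_le_sum_le (hW : ∀ i, HasLaw (W i) ν P) (hind : iIndepFun W P)
    {g : E → ℝ} (hg : Measurable g) {b v H : ℝ} (hb0 : 0 ≤ b)
    (hb : ∀ᵐ z ∂ν, |g z| ≤ b) (hmean : ∫ z, g z ∂ν = 0) (hv : ∫ z, g z ^ 2 ∂ν ≤ v)
    (hH : 0 ≤ H) (hnv : 0 < n * v) (hHb : H * b ^ 2 ≤ n * v) :
    P {ω | 2 * √(H * (n * v)) ≤ ∑ i, g (W i ω)} ≤ ENNReal.ofReal (Real.exp (-H)) := by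
  have hne := hnv.ne'
  have hs : √(H / (n * v)) * b ≤ 1 := by
    rw [← Real.sqrt_sq hb0, ← Real.sqrt_mul (by positivity)]
    refine Real.sqrt_le_one.2 ?_
    rw [div_mul_eq_mul_div]
    exact (div_le_one hnv).2 hHb
  refine (measure_le_sum_le_exp hW hind hg _ hb hmean hv (Real.sqrt_nonneg _) hs).trans_eq ?_
  have e1 : √(H / (n * v)) ^ 2 = H / (n * v) := Real.sq_sqrt (by positivity)
  have e2 : √(H / (n * v)) * √(H * (n * v)) = H := by
    rw [← Real.sqrt_mul (by positivity)]
    have : H / (n * v) * (H * (n * v)) = H ^ 2 := by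
      rw [← mul_assoc, mul_right_comm, div_mul_cancel₀ _ hne, sq]
    rw [this, Real.sqrt_sq hH]
  have e3 : n * (√(H / (n * v)) ^ 2 * v) = H := by
    rw [e1, mul_left_comm, div_mul_cancel₀ _ hne]
  rw [e3]
  congr 2
  linear_combination (-2) * e2

theorem integral_indicator_one_sub_sq_le {A : Set E} (hA : MeasurableSet A) :
    ∫ z, (A.indicator (1 : E → ℝ) z - ν.real A) ^ 2 ∂ν ≤ ν.real A := by
  have h0 : Integrable (A.indicator (1 : E → ℝ)) ν := (integrable_const (1 : ℝ)).indicator hA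
  have h1 : ∀ z, (A.indicator (1 : E → ℝ) z - ν.real A) ^ 2 =
      (1 - 2 * ν.real A) * A.indicator (1 : E → ℝ) z + ν.real A ^ 2 := by
    intro z
    by_cases hz : z ∈ A
    · simp [hz]; ring
    · simp [hz]
  simp_rw [h1]
  rw [integral_add (by fun_prop) (by fun_prop), integral_const_mul, integral_indicator_one hA]
  simp only [integral_const, probReal_univ, smul_eq_mul, one_mul]
  nlinarith [sq_nonneg (ν.real A)]

theorem integral_indicator_one_sub_eq_zero {A : Set E} (hA : MeasurableSet A) :
    ∫ z, (A.indicator (1 : E → ℝ) z - ν.real A) ∂ν = 0 := by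
  have h0 : Integrable (A.indicator (1 : E → ℝ)) ν := (integrable_const (1 : ℝ)).indicator hA
  rw [integral_sub h0 (by fun_prop), integral_indicator_one hA]
  simp

theorem abs_indicator_one_sub_le_one {A : Set E} (z : E) :
    |A.indicator (1 : E → ℝ) z - ν.real A| ≤ 1 := by
  have h1 : ν.real A ≤ 1 := measureReal_le_one
  have h0 : 0 ≤ ν.real A := measureReal_nonneg
  rw [abs_le]
  by_cases hz : z ∈ A
  · rw [Set.indicator_of_mem hz, Pi.one_apply]; constructor <;> linarith
  · rw [Set.indicator_of_notMem hz]; constructor <;> linarith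

theorem measure_count_lt_le (hW : ∀ i, HasLaw (W i) ν P) (hind : iIndepFun W P) {A : Set E}
    (hA : MeasurableSet A) {H : ℝ} (hH : 0 ≤ H) (hp : 0 < n * ν.real A)
    (hHp : H ≤ n * ν.real A) :
    P {ω | ∑ i, A.indicator (1 : E → ℝ) (W i ω) < n * ν.real A - 2 * √(H * (n * ν.real A))} ≤
      ENNReal.ofReal (Real.exp (-H)) := by
  have hm : Measurable (A.indicator (1 : E → ℝ)) := measurable_one.indicator hA
  refine (measure_mono ?_).trans (measure_two_mul_sqrt_le_sum_le hW hind
    (g := fun z => -(A.indicator (1 : E → ℝ) z - ν.real A)) (b := 1) (v := ν.real A)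
    (by fun_prop) zero_le_one (ae_of_all _ fun z => ?_) ?_ ?_ hH hp (by simpa using hHp))
  · intro ω hω
    simp only [Set.mem_ofPred_eq, Finset.sum_neg_distrib, Finset.sum_sub_distrib,
      Finset.sum_const, Finset.card_univ, Fintype.card_fin, nsmul_eq_mul] at hω ⊢
    linarith
  · rw [abs_neg]; exact abs_indicator_one_sub_le_one z
  · rw [integral_neg, integral_indicator_one_sub_eq_zero hA, neg_zero]
  · simp_rw [neg_sq]; exact integral_indicator_one_sub_sq_le hA

/-- Here `s = 1`. No lower bound on the measure of `A` is needed, so this applies to the thin shell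
of a bracket. -/
theorem measure_lt_count_le (hW : ∀ i, HasLaw (W i) ν P) (hind : iIndepFun W P) {A : Set E}
    (hA : MeasurableSet A) (H : ℝ) :
    P {ω | 2 * (n * ν.real A) + H < ∑ i, A.indicator (1 : E → ℝ) (W i ω)} ≤
      ENNReal.ofReal (Real.exp (-H)) := by
  have hm : Measurable (A.indicator (1 : E → ℝ)) := measurable_one.indicator hA
  refine (measure_mono ?_).trans ((measure_le_sum_le_exp hW hind
    (g := fun z => A.indicator (1 : E → ℝ) z - ν.real A) (b := 1) (v := ν.real A) (s := 1)
    (by fun_prop) (n * ν.real A + H) (ae_of_all _ fun z => abs_indicator_one_sub_le_one z)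
    (integral_indicator_one_sub_eq_zero hA) (integral_indicator_one_sub_sq_le hA) zero_le_one
    (by simp)).trans_eq ?_)
  · intro ω hω
    simp only [Set.mem_ofPred_eq, Finset.sum_sub_distrib,
      Finset.sum_const, Finset.card_univ, Fintype.card_fin, nsmul_eq_mul] at hω ⊢
    linarith
  · congr 2; ring

theorem abs_integral_cond_le {A : Set E} {f : E → ℝ} {M : ℝ} (hp : 0 < ν.real A)
    (hM : ∀ᵐ z ∂ν, |f z| ≤ M) : |∫ z, f z ∂(ν[|A])| ≤ M := by
  have hne : ν A ≠ 0 := fun h => by simp [measureReal_def, h] at hp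
  have := cond_isProbabilityMeasure hne
  have h1 := norm_integral_le_of_norm_le_const (μ := ν[|A]) (f := f) (C := M)
    (cond_absolutelyContinuous.ae_le hM)
  simpa using h1

/-- Centring at the conditional mean gives second moment at most `ν.real A * M ^ 2`, although the
summands are only bounded by `2 * M`. Using `M` and not `2 * M` in the leading term is what makes
the final constant 9 attainable. -/
theorem measure_lt_abs_sum_indicator_le (hW : ∀ i, HasLaw (W i) ν P) (hind : iIndepFun W P)
    {A : Set E} (hA : MeasurableSet A) {f : E → ℝ} (hf : Measurable f) {M H : ℝ}
    (hM0 : 0 ≤ M) (hM : ∀ᵐ z ∂ν, |f z| ≤ M)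
    (hH : 0 ≤ H) (hp : 0 < n * ν.real A) (hHp : 4 * H ≤ n * ν.real A) :
    P {ω | 2 * M * √(H * (n * ν.real A)) <
        |∑ i, A.indicator (fun z => f z - ∫ z, f z ∂(ν[|A])) (W i ω)|} ≤
      2 * ENNReal.ofReal (Real.exp (-H)) := by
  set m := ∫ z, f z ∂(ν[|A]) with hm_def
  set g : E → ℝ := A.indicator (fun z => f z - m) with hg_def
  have hp' : 0 < ν.real A := pos_of_mul_pos_right hp (Nat.cast_nonneg n)
  have hm : |m| ≤ M := abs_integral_cond_le hp' hM
  have hgm : Measurable g := (hf.sub_const m).indicator hA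
  have hgb : ∀ᵐ z ∂ν, |g z| ≤ 2 * M := by
    filter_upwards [hM] with z hz
    by_cases hzA : z ∈ A
    · rw [hg_def, Set.indicator_of_mem hzA]
      exact (abs_sub _ _).trans (by linarith)
    · rw [hg_def, Set.indicator_of_notMem hzA, abs_zero]; linarith
  -- For `M = 0` the variance bound is zero and the Bernstein bound does not apply, but all summands
  -- vanish almost surely.
  rcases hM0.eq_or_lt with rfl | hMpos
  · refine le_trans (le_of_eq ?_) zero_le
    rw [mul_zero, zero_mul]
    have hbW : ∀ᵐ ω ∂P, ∀ i, |g (W i ω)| ≤ 0 := by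
      rw [ae_all_iff]
      intro i
      have h := hgb
      rw [← (hW i).map_eq, mul_zero] at h
      exact ae_of_ae_map (hW i).aemeasurable h
    rw [measure_eq_zero_iff_ae_notMem]
    filter_upwards [hbW] with ω hω
    have h0 : ∀ i, g (W i ω) = 0 := fun i => abs_nonpos_iff.1 (hω i)
    simp [h0]
  have hfi : Integrable f ν := .of_bound hf.aestronglyMeasurable M hM
  have hfi2 : Integrable (fun z => f z ^ 2) ν := by
    refine .of_bound (hf.pow_const 2).aestronglyMeasurable (M ^ 2) ?_
    filter_upwards [hM] with z hz
    simpa using pow_le_pow_left₀ (abs_nonneg _) hz 2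
  have hmul : ν.real A * m = ∫ z in A, f z ∂ν := measureReal_mul_integral_cond hp' f
  have hmean : ∫ z, g z ∂ν = 0 := by
    rw [hg_def, integral_indicator hA, integral_sub hfi.integrableOn (by fun_prop), ← hmul]
    simp
  have hvar : ∫ z, g z ^ 2 ∂ν ≤ ν.real A * M ^ 2 := by
    have h1 : ∀ z, g z ^ 2 = A.indicator (fun z => f z ^ 2 - 2 * m * f z + m ^ 2) z := by
      intro z
      by_cases hz : z ∈ A
      · simp only [hg_def, Set.indicator_of_mem hz]; ring
      · simp [hg_def, Set.indicator_of_notMem hz]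
    simp_rw [h1]
    have h2 : ∫ z in A, f z ^ 2 ∂ν ≤ ν.real A * M ^ 2 := by
      calc ∫ z in A, f z ^ 2 ∂ν ≤ ∫ z in A, M ^ 2 ∂ν := by
            refine integral_mono_ae hfi2.integrableOn (by fun_prop) (ae_restrict_of_ae ?_)
            filter_upwards [hM] with z hz
            simpa using pow_le_pow_left₀ (abs_nonneg _) hz 2
        _ = _ := by simp
    have i1 := hfi2.integrableOn (s := A)
    have i2 := (hfi.integrableOn (s := A)).const_mul (2 * m)
    have i12 : Integrable (fun z => f z ^ 2 - 2 * m * f z) (ν.restrict A) := i1.sub i2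
    rw [integral_indicator hA, integral_add i12 (integrable_const _), integral_sub i1 i2,
      integral_const_mul, ← hmul]
    simp only [integral_const, measureReal_restrict_apply_univ, smul_eq_mul]
    nlinarith [sq_nonneg m]
  have hnv : 0 < n * (ν.real A * M ^ 2) := by rw [← mul_assoc]; positivity
  have hHb : H * (2 * M) ^ 2 ≤ n * (ν.real A * M ^ 2) := by nlinarith [sq_nonneg M]
  have hsq : 2 * √(H * (n * (ν.real A * M ^ 2))) = 2 * M * √(H * (n * ν.real A)) := by
    rw [← mul_assoc, ← mul_assoc, mul_assoc H, Real.sqrt_mul (by positivity), Real.sqrt_sq hM0]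
    ring
  have hup := measure_two_mul_sqrt_le_sum_le hW hind hgm (by positivity) hgb hmean hvar hH hnv hHb
  have hlo := measure_two_mul_sqrt_le_sum_le hW hind (g := fun z => - g z) hgm.neg
    (by positivity) (by simpa using hgb) (by rw [integral_neg, hmean, neg_zero])
    (by simpa using hvar) hH hnv hHb
  rw [hsq] at hup hlo
  rw [two_mul (ENNReal.ofReal _)]
  refine (measure_mono ?_).trans ((measure_union_le _ _).trans (add_le_add hup hlo))
  intro ω hω
  simp only [Set.mem_union, Set.mem_ofPred_eq, Finset.sum_neg_distrib] at hω ⊢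
  rcases lt_abs.1 hω with h | h
  · exact Or.inl h.le
  · exact Or.inr h.le

end Bernstein

/-! ### Comparing a leaf with its bracket. -/

theorem sum_indicesIn {n d : ℕ} (x : Fin n → Fin d → ℝ) (A : Set (Fin d → ℝ)) (y : Fin n → ℝ)
    (g : (Fin d → ℝ) × ℝ → ℝ) :
    ∑ i, (Prod.fst ⁻¹' A).indicator g (x i, y i) = ∑ i ∈ indicesIn x A, g (x i, y i) := by
  classical
  unfold indicesIn
  rw [Finset.sum_filter]
  exact Finset.sum_congr rfl fun i _ => by simp [Set.indicator_apply]

theorem sum_indicator_one_eq_count {n d : ℕ} (x : Fin n → Fin d → ℝ) (A : Set (Fin d → ℝ))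
    (y : Fin n → ℝ) :
    ∑ i, (Prod.fst ⁻¹' A).indicator (1 : (Fin d → ℝ) × ℝ → ℝ) (x i, y i) = count x A := by
  rw [sum_indicesIn]; simp [count]

theorem abs_sum_sub_le {n d : ℕ} {x : Fin n → Fin d → ℝ} {y : Fin n → ℝ} {M : ℝ}
    {A L B : Set (Fin d → ℝ)} (hAL : A ⊆ L) (hLB : L ⊆ B) (hy : ∀ i, |y i| ≤ M) {mA : ℝ} (mL : ℝ)
    (hmA : |mA| ≤ M) :
    |∑ i ∈ indicesIn x L, y i - mL * count x L| ≤
      |∑ i ∈ indicesIn x A, (y i - mA)| + 2 * M * count x (B \ A) + |mA - mL| * count x L := by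
  classical
  have hsub : indicesIn x A ⊆ indicesIn x L := fun i hi => by
    simp only [indicesIn, Finset.mem_filter, Finset.mem_univ, true_and] at hi ⊢
    exact hAL hi
  have hcard : ((indicesIn x L \ indicesIn x A).card : ℝ) ≤ count x (B \ A) := by
    have : indicesIn x L \ indicesIn x A ⊆ indicesIn x (B \ A) := fun i hi => by
      simp only [indicesIn, Finset.mem_sdiff, Finset.mem_filter, Finset.mem_univ, true_and] at hi ⊢
      exact ⟨hLB hi.1, hi.2⟩
    exact_mod_cast Finset.card_le_card this
  have hM0 : 0 ≤ M := (abs_nonneg _).trans hmA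
  -- Points in `A` carry the centred sum, those in `L \ A` are bounded trivially, and the last term
  -- replaces the mean on `A` by the mean on `L`.
  have e : ∑ i ∈ indicesIn x L, y i - mL * count x L =
      ∑ i ∈ indicesIn x A, (y i - mA) + ∑ i ∈ indicesIn x L \ indicesIn x A, (y i - mA) +
        (mA - mL) * count x L := by
    rw [add_comm (∑ i ∈ indicesIn x A, (y i - mA)), Finset.sum_sdiff hsub,
      Finset.sum_sub_distrib, Finset.sum_const, nsmul_eq_mul]
    unfold count
    ring
  have h2 : |∑ i ∈ indicesIn x L \ indicesIn x A, (y i - mA)| ≤ 2 * M * count x (B \ A) := by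
    calc _ ≤ ∑ i ∈ indicesIn x L \ indicesIn x A, |y i - mA| := Finset.abs_sum_le_sum_abs _ _
      _ ≤ ∑ _i ∈ indicesIn x L \ indicesIn x A, 2 * M :=
          Finset.sum_le_sum fun i _ => (abs_sub _ _).trans (by linarith [hy i])
      _ = (indicesIn x L \ indicesIn x A).card * (2 * M) := by simp
      _ ≤ count x (B \ A) * (2 * M) := by gcongr
      _ = _ := by ring
  rw [e]
  refine (abs_add_three _ _ _).trans ?_
  rw [abs_mul (mA - mL), abs_of_nonneg (Nat.cast_nonneg (α := ℝ) (count x L))]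
  linarith

theorem abs_integral_cond_sub_le {E : Type*} [MeasurableSpace E] {ν : Measure E}
    [IsProbabilityMeasure ν] {A L : Set E} (hA : MeasurableSet A) (hL : MeasurableSet L)
    (hAL : A ⊆ L) (hp : 0 < ν.real A) {f : E → ℝ} (hf : Measurable f) {M : ℝ}
    (hM : ∀ᵐ z ∂ν, |f z| ≤ M) :
    |∫ z, f z ∂(ν[|A]) - ∫ z, f z ∂(ν[|L])| ≤ 2 * M * (ν.real (L \ A) / ν.real A) := by
  have hle : ν.real A ≤ ν.real L := measureReal_mono hAL
  have hpL := hp.trans_le hle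
  have hfi : Integrable f ν := .of_bound hf.aestronglyMeasurable M hM
  have h1 := measureReal_mul_integral_cond hp f
  have h2 := measureReal_mul_integral_cond hpL f
  have hmA := abs_integral_cond_le hp hM
  set mA := ∫ z, f z ∂(ν[|A])
  set mL := ∫ z, f z ∂(ν[|L])
  have h3 : ∫ z in L, f z ∂ν = ∫ z in A, f z ∂ν + ∫ z in L \ A, f z ∂ν := by
    rw [← setIntegral_union Set.disjoint_sdiff_right (hL.diff hA) hfi.integrableOn
      hfi.integrableOn, Set.union_sdiff_cancel hAL]
  have h4 : |∫ z in L \ A, f z ∂ν| ≤ M * ν.real (L \ A) := by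
    have := norm_integral_le_of_norm_le_const (μ := ν.restrict (L \ A)) (f := f) (C := M)
      (ae_restrict_of_ae hM)
    simpa using this
  have h5 : ν.real (L \ A) = ν.real L - ν.real A := measureReal_sdiff hAL hA
  have h6 : ν.real L * (mA - mL) = ν.real (L \ A) * mA - ∫ z in L \ A, f z ∂ν := by
    rw [mul_sub, h2, h3, ← h1, h5]; ring
  have hq : 0 ≤ ν.real (L \ A) := measureReal_nonneg
  have h7 : ν.real L * |mA - mL| ≤ 2 * M * ν.real (L \ A) := by
    have h8 := abs_mul (ν.real L) (mA - mL)
    rw [abs_of_pos hpL] at h8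
    rw [← h8, h6]
    refine (abs_sub _ _).trans ?_
    rw [abs_mul, abs_of_nonneg hq]
    nlinarith
  rw [mul_div_assoc', le_div_iff₀ hp, mul_comm]
  exact (mul_le_mul_of_nonneg_right hle (abs_nonneg _)).trans h7

theorem HasBoundedDensity.measureReal_le {d : ℕ} {ζ : ℝ} {μ : Measure (Fin d → ℝ)}
    (h : HasBoundedDensity ζ μ) (hζ : 0 ≤ ζ) {A : Set (Fin d → ℝ)} (hA : MeasurableSet A)
    (hAfin : volume A ≠ ⊤) : μ.real A ≤ ζ * volume.real A := by
  obtain ⟨f, hf, hfb, rfl⟩ := h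
  have h1 : (volume.restrict (unitCube d)).withDensity (fun x => ENNReal.ofReal (f x)) A ≤
      ENNReal.ofReal ζ * volume A := by
    rw [withDensity_apply _ hA, Measure.restrict_restrict hA]
    calc ∫⁻ z in A ∩ unitCube d, ENNReal.ofReal (f z)
        ≤ ∫⁻ _z in A ∩ unitCube d, ENNReal.ofReal ζ :=
          setLIntegral_mono measurable_const
            fun z hz => ENNReal.ofReal_le_ofReal (hfb z hz.2).2
      _ = ENNReal.ofReal ζ * volume (A ∩ unitCube d) := by simp
      _ ≤ _ := by gcongr; exact Set.inter_subset_left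
  have h2 := ENNReal.toReal_mono (ENNReal.mul_ne_top ENNReal.ofReal_ne_top hAfin) h1
  rwa [ENNReal.toReal_mul, ENNReal.toReal_ofReal hζ] at h2

theorem HasBoundedDensity.le_measureReal {d : ℕ} {ζ : ℝ} {μ : Measure (Fin d → ℝ)}
    [IsFiniteMeasure μ] (h : HasBoundedDensity ζ μ) (hζ : 0 < ζ) {A : Set (Fin d → ℝ)}
    (hA : MeasurableSet A) (hAsub : A ⊆ unitCube d) : volume.real A ≤ ζ * μ.real A := by
  have hfin : μ A ≠ ⊤ := measure_ne_top _ _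
  obtain ⟨f, hf, hfb, rfl⟩ := h
  have h1 : ENNReal.ofReal ζ⁻¹ * volume A ≤
      (volume.restrict (unitCube d)).withDensity (fun x => ENNReal.ofReal (f x)) A := by
    rw [withDensity_apply _ hA, Measure.restrict_restrict hA, Set.inter_eq_left.2 hAsub]
    calc ENNReal.ofReal ζ⁻¹ * volume A = ∫⁻ _z in A, ENNReal.ofReal ζ⁻¹ := by simp
      _ ≤ _ := setLIntegral_mono (by fun_prop)
            fun z hz => ENNReal.ofReal_le_ofReal (hfb z (hAsub hz)).1
  have h2 := ENNReal.toReal_mono hfin h1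
  rw [ENNReal.toReal_mul, ENNReal.toReal_ofReal (by positivity)] at h2
  rwa [measureReal_def, measureReal_def, ← inv_mul_le_iff₀ hζ]

theorem mul_le_div_of_concentration {M H δ t N NA C k s e : ℝ} (hM : 0 ≤ M) (hH : 0 ≤ H)
    (hδ : 0 ≤ δ) (hk : 0 < k) (ht : 0 < t) (htH : 64 * H ≤ t) (hNA : t - 2 * √(H * t) ≤ NA)
    (hNAN : NA ≤ N) (hkN : k ≤ N) (hC : C ≤ 2 * (δ * t) + H) (he : e ≤ 2 * M * δ)
    (hs : |s| ≤ 2 * M * √(H * t) + 2 * M * C + e * N) :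
    |s / N| ≤ 2 * M * √(4 / 3 * H / k) + 8 * M * δ + 2 * M * H / k := by
  have hN : 0 < N := hk.trans_le hkN
  -- As `64 * H ≤ t`, the deviation `2 * √(H * t)` is at most `t / 4`; so at least three quarters of
  -- the expected points are present and `t ≤ 4 / 3 * N`.
  have h1 : √(H * t) ≤ t / 8 := by
    refine Real.sqrt_le_iff.2 ⟨by positivity, ?_⟩
    nlinarith
  have htN : t ≤ 4 / 3 * N := by linarith
  have h2 : √(H * t) ≤ √(4 / 3 * H / k) * N := by
    rw [show √(4 / 3 * H / k) * N = √(4 / 3 * H / k * N ^ 2) by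
      rw [Real.sqrt_mul (by positivity), Real.sqrt_sq hN.le]]
    refine Real.sqrt_le_sqrt ?_
    rw [div_mul_eq_mul_div, le_div_iff₀ hk]
    calc H * t * k ≤ H * (4 / 3 * N) * N := by gcongr
      _ = _ := by ring
  have h3 : H ≤ H / k * N := by
    rw [div_mul_eq_mul_div, le_div_iff₀ hk]; gcongr
  rw [abs_div, abs_of_pos hN, div_le_iff₀ hN]
  calc |s| ≤ 2 * M * √(H * t) + 2 * M * C + e * N := hs
    _ ≤ 2 * M * (√(4 / 3 * H / k) * N) + 2 * M * (2 * (δ * (4 / 3 * N)) + H / k * N) +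
        2 * M * δ * N := by
      gcongr
      exact hC.trans (by gcongr)
    _ ≤ _ := by
      have : 0 ≤ M * δ * N := by positivity
      have e : 2 * M * H / k = 2 * M * (H / k) := by ring
      rw [e]
      nlinarith

/-- The budget is `9 = 7 + 1 + 1`: the main term is `2 * √12 ≤ 7` times `M * √(U / k)`, and the
bracketing and lower-order terms take one unit each. -/
theorem error_le_nine_mul {M ζ U k ε : ℝ} (hM : 0 ≤ M) (hζ : 1 ≤ ζ) (hk : 1 ≤ k)
    (hU : 100 * ζ ^ 4 ≤ U) (hUk : 9216 * ζ ^ 2 * U ≤ k) (hε : ε ≤ 1 / k) :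
    2 * M * √(4 / 3 * (9 * U) / k) + 8 * M * (ζ ^ 2 * ε) + 2 * M * (9 * U) / k ≤
      9 * M * √U * (1 / √k) := by
  have hk0 : 0 < k := by linarith
  have hζ2 : 1 ≤ ζ ^ 2 := one_le_pow₀ hζ
  have hU0 : 0 < U := by have : 0 < ζ ^ 4 := by positivity
                         linarith
  have hUk' : 9216 * U ≤ k := by nlinarith
  have e0 : 9 * M * √U * (1 / √k) = 9 * M * √(U / k) := by
    rw [Real.sqrt_div hU0.le]; ring
  have h1 : √(4 / 3 * (9 * U) / k) ≤ 7 / 2 * √(U / k) := by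
    rw [show (4 / 3 * (9 * U) / k) = 12 * (U / k) by ring, Real.sqrt_mul (by norm_num)]
    gcongr
    exact Real.sqrt_le_iff.2 ⟨by norm_num, by norm_num⟩
  have h2 : 8 * (ζ ^ 2 * ε) ≤ √(U / k) := by
    refine le_trans (b := 8 * (ζ ^ 2 * (1 / k))) (by gcongr) (Real.le_sqrt_of_sq_le ?_)
    rw [show (8 * (ζ ^ 2 * (1 / k))) ^ 2 = 64 * ζ ^ 4 / k / k by ring]
    gcongr
    rw [div_le_iff₀ hk0]
    nlinarith
  have h3 : 2 * (9 * U) / k ≤ √(U / k) := by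
    refine Real.le_sqrt_of_sq_le ?_
    rw [show (2 * (9 * U) / k) ^ 2 = U / k * (324 * U / k) by ring]
    refine mul_le_of_le_one_right (by positivity) ?_
    rw [div_le_one hk0]; linarith
  rw [e0]
  calc _ = M * (2 * √(4 / 3 * (9 * U) / k) + 8 * (ζ ^ 2 * ε) + 2 * (9 * U) / k) := by ring
    _ ≤ M * (2 * (7 / 2 * √(U / k)) + √(U / k) + √(U / k)) := by gcongr
    _ = _ := by ring

/-- Inner sets have volume at least half of `k / (8 * ζ * n)` and density at least `ζ⁻¹`; their
expected counts are thus of order `k`, as the Bernstein bounds require. -/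
theorem IsBracket.le_mul_measureReal {n d : ℕ} {ν : Measure ((Fin d → ℝ) × ℝ)}
    [IsProbabilityMeasure ν] {ζ k ε : ℝ} {p : Set (Fin d → ℝ) × Set (Fin d → ℝ)}
    (hp : IsBracket (k / (8 * ζ * n)) ε p) (hn : 0 < n) (hζ : 0 < ζ)
    (hX : HasBoundedDensity ζ (ν.map Prod.fst)) :
    k ≤ 16 * ζ ^ 2 * (n * ν.real (Prod.fst ⁻¹' p.1)) := by
  have : IsProbabilityMeasure (ν.map Prod.fst) :=
    Measure.isProbabilityMeasure_map measurable_fst.aemeasurable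
  have hn' : (0 : ℝ) < n := by exact_mod_cast hn
  have hvA := hX.le_measureReal hζ hp.measurableSet_fst hp.subset_unitCube
  rw [map_measureReal_apply measurable_fst hp.measurableSet_fst] at hvA
  have hwA := hp.le_volume
  have hnw : n * (ζ * (k / (8 * ζ * n))) = k / 8 := by field_simp
  have : n * (ζ * (k / (8 * ζ * n))) ≤ n * (ζ * (2 * (ζ * ν.real (Prod.fst ⁻¹' p.1)))) := by
    gcongr; linarith
  linarith

/-- The deviations, on the bracket `p`, of the sample from its law. -/
def badEvent {Ω : Type*} {n d : ℕ} (ν : Measure ((Fin d → ℝ) × ℝ))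
    (X : Fin n → Ω → (Fin d → ℝ)) (Y : Fin n → Ω → ℝ) (M H : ℝ)
    (p : Set (Fin d → ℝ) × Set (Fin d → ℝ)) : Set Ω :=
  {ω | ((count (fun i => X i ω) p.1 : ℝ) <
        n * ν.real (Prod.fst ⁻¹' p.1) - 2 * √(H * (n * ν.real (Prod.fst ⁻¹' p.1)))) ∨
      (2 * M * √(H * (n * ν.real (Prod.fst ⁻¹' p.1))) <
        |∑ i ∈ indicesIn (fun i => X i ω) p.1,
          (Y i ω - ∫ z, z.2 ∂(ν[|Prod.fst ⁻¹' p.1]))|) ∨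
      (2 * (n * ν.real (Prod.fst ⁻¹' (p.2 \ p.1))) + H < count (fun i => X i ω) (p.2 \ p.1)) ∨
      2 * (n * ν.real (Prod.fst ⁻¹' p.2)) + H < count (fun i => X i ω) p.2}

/-- Off the bad events of a suitable family of brackets, every valid tree is close to the
partition-optimal tree. -/
theorem abs_tree_sub_optimalTree_le {Ω : Type*} {n d : ℕ} {ν : Measure ((Fin d → ℝ) × ℝ)}
    {X : Fin n → Ω → (Fin d → ℝ)} {Y : Fin n → Ω → ℝ} {ζ α M U : ℝ} {k S : ℕ}
    [IsProbabilityMeasure ν]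
    (hn : 0 < n) (hζ : 1 ≤ ζ) (hk : 0 < k) (hkn : k ≤ n)
    (hM : 0 ≤ M) (hY : ∀ᵐ p ∂ν, |p.2| ≤ M) (hX : HasBoundedDensity ζ (ν.map Prod.fst))
    (hU : 100 * ζ ^ 4 ≤ U) (hUk : 9216 * ζ ^ 2 * U ≤ k) {ε : ℝ} (hε0 : 0 ≤ ε) (hε : ε ≤ 1 / k)
    {R : Finset (Set (Fin d → ℝ) × Set (Fin d → ℝ))}
    (hR : ∀ p ∈ R, IsBracket ((k : ℝ) / (8 * ζ * n)) ε p)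
    (hRbox : ∀ a b : Fin d → ℝ, IsSubbox a b → (boxSupport a b).card ≤ S →
      (k : ℝ) / (8 * ζ * n) ≤ ∏ j, (b j - a j) →
        ∃ p ∈ R, p.1 ⊆ Set.univ.pi (fun j => Set.Ioc (a j) (b j)) ∧ Set.Icc a b ⊆ p.2 ∧
          volume.real p.2 ≤ 2 * ∏ j, (b j - a j))
    {ω : Ω} (hgood : ∀ p ∈ R, ω ∉ badEvent ν X Y M (9 * U) p) (hYω : ∀ i, |Y i ω| ≤ M)
    {Λ : Set (Set (Fin d → ℝ))} (hΛ : Λ ∈ validPartitions α k (fun i => X i ω))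
    (hbox : ∀ L ∈ Λ, IsNearBox S L) {z : Fin d → ℝ} (hz : z ∈ unitCube d) :
    |tree (fun i => X i ω) (fun i => Y i ω) Λ z - optimalTree ν Λ z| ≤
      9 * M * √U * (1 / √k) := by
  obtain ⟨L, ⟨hL, hzL⟩, -⟩ := hΛ.1.existsUnique.2 z hz
  have hcount := hΛ.2 L hL
  obtain ⟨hLm, a, b, hab, hL1, hL2, hsupp⟩ := hbox L hL
  rw [tree, optimalTree, cell_eq hΛ.1 hL hzL]
  set x : Fin n → Fin d → ℝ := fun i => X i ω with hx
  have hζ0 : 0 < ζ := by linarith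
  have hn' : (0 : ℝ) < n := by exact_mod_cast hn
  have hk' : (0 : ℝ) < k := by exact_mod_cast hk
  have hk1 : (1 : ℝ) ≤ k := by exact_mod_cast hk
  have hkn' : (k : ℝ) ≤ n := by exact_mod_cast hkn
  have hU0 : 0 < U := by have : 0 < ζ ^ 4 := by positivity
                         linarith
  have hζ2 : 1 ≤ ζ ^ 2 := one_le_pow₀ hζ
  have hUk' : 9216 * U ≤ k := by nlinarith
  set w : ℝ := (k : ℝ) / (8 * ζ * n) with hw
  have hw0 : 0 < w := by positivity
  have hnw : n * (ζ * w) = k / 8 := by rw [hw]; field_simp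
  have hw1 : w ≤ 1 := by
    rw [hw, div_le_one (by positivity)]
    nlinarith
  have : IsProbabilityMeasure (ν.map Prod.fst) :=
    Measure.isProbabilityMeasure_map measurable_fst.aemeasurable
  have hmap : ∀ A : Set (Fin d → ℝ), MeasurableSet A →
      (ν.map Prod.fst).real A = ν.real (Prod.fst ⁻¹' A) := fun A hA =>
    map_measureReal_apply measurable_fst hA
  by_cases hV : w ≤ ∏ j, (b j - a j)
  · obtain ⟨p, hpR, hp1, hp2, -⟩ := hRbox a b hab hsupp hV
    have hp := hR p hpR
    have hg := hgood p hpR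
    simp only [badEvent, Set.mem_ofPred_eq, not_or, not_lt] at hg
    obtain ⟨g1, g2, g3, -⟩ := hg
    have hAL : p.1 ⊆ L := hp1.trans hL1
    have hLB : L ⊆ p.2 := hL2.trans hp2
    have hvA := hX.le_measureReal hζ0 hp.measurableSet_fst hp.subset_unitCube
    have hmD := hp.measurableSet_snd.diff hp.measurableSet_fst
    have hvD := hX.measureReal_le hζ0.le hmD
      (measure_ne_top_of_subset Set.sdiff_subset hp.volume_ne_top)
    rw [hmap _ hp.measurableSet_fst] at hvA
    rw [hmap _ hmD] at hvD
    have hwA := hp.le_volume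
    have htk := hp.le_mul_measureReal hn hζ0 hX
    have hεD := hp.volume_diff_le
    set pA := ν.real (Prod.fst ⁻¹' p.1)
    set pD := ν.real (Prod.fst ⁻¹' (p.2 \ p.1))
    have hpA : w ≤ 2 * (ζ * pA) := by linarith
    have hpApos : 0 < pA := by
      have : 0 < ζ * pA := by linarith
      exact pos_of_mul_pos_right this hζ0.le
    have hDA : pD ≤ ζ ^ 2 * ε * pA := by
      calc pD ≤ ζ * volume.real (p.2 \ p.1) := hvD
        _ ≤ ζ * (ε * (ζ * pA)) := by gcongr; exact hεD.trans (by gcongr)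
        _ = _ := by ring
    -- The constant is `9216 = 16 * 64 * 9`, with 16 from the lower bound on the expected count.
    have htH : 64 * (9 * U) ≤ n * pA := by
      have : ζ ^ 2 * (64 * (9 * U)) ≤ ζ ^ 2 * (n * pA) := by linarith
      exact le_of_mul_le_mul_left this (by positivity)
    have hmA := abs_integral_cond_le hpApos hY
    have hfst : Measurable (Prod.fst : (Fin d → ℝ) × ℝ → Fin d → ℝ) := measurable_fst
    have hdiff := abs_integral_cond_sub_le (hfst hp.measurableSet_fst) (hfst hLm)
      (Set.preimage_mono hAL) hpApos measurable_snd hY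
    set mA := ∫ z, z.2 ∂(ν[|Prod.fst ⁻¹' p.1])
    set mL := ∫ z, z.2 ∂(ν[|Prod.fst ⁻¹' L])
    have hsum := abs_sum_sub_le (x := x) hAL hLB hYω mL hmA
    have hNpos : (0 : ℝ) < count x L := by exact_mod_cast hk.trans_le hcount
    have key := mul_le_div_of_concentration (M := M) (H := 9 * U) (δ := ζ ^ 2 * ε) (t := n * pA)
      (N := count x L) (NA := count x p.1) (C := count x (p.2 \ p.1)) (k := k)
      (s := ∑ i ∈ indicesIn x L, Y i ω - mL * count x L) (e := |mA - mL|) hM (by positivity)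
      (by positivity) hk' (by positivity) htH g1 (by exact_mod_cast count_mono x hAL)
      (by exact_mod_cast hcount) (g3.trans ?_) (hdiff.trans ?_) (hsum.trans ?_)
    · rw [sub_div, mul_div_cancel_right₀ _ hNpos.ne'] at key
      exact key.trans (error_le_nine_mul hM hζ hk1 hU hUk hε)
    · have : n * pD ≤ n * (ζ ^ 2 * ε * pA) := by gcongr
      linarith
    · have : ν.real (Prod.fst ⁻¹' L \ Prod.fst ⁻¹' p.1) ≤ pD :=
        measureReal_mono (fun y hy => ⟨hLB hy.1, hy.2⟩)
      gcongr
      rw [div_le_iff₀ hpApos]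
      exact this.trans hDA
    · gcongr
  -- A box of volume below `w` is enlarged to volume `w`, whose outer set has volume at most `2 * w`
  -- and expected count at most `2 * ζ * w * n = k / 4`. Its count is then at most `k / 2 + 9 * U <
  -- k`, so the box cannot contain a leaf.
  · exfalso
    obtain ⟨a', b', hab', hsupp', hsub, hw'⟩ := exists_superbox hab (not_le.1 hV).le hw1
    obtain ⟨p, hpR, -, hp2, hp3⟩ := hRbox a' b' hab' (hsupp'.trans hsupp) hw'.ge
    have hp := hR p hpR
    have hg := hgood p hpR
    simp only [badEvent, Set.mem_ofPred_eq, not_or, not_lt] at hg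
    obtain ⟨-, -, -, g4⟩ := hg
    have hvB := hX.measureReal_le hζ0.le hp.measurableSet_snd hp.volume_ne_top
    rw [hmap _ hp.measurableSet_snd] at hvB
    rw [hw'] at hp3
    have h1 : (k : ℝ) ≤ count x p.2 := by
      exact_mod_cast hcount.trans (count_mono x (hL2.trans (hsub.trans hp2)))
    have h2 : n * ν.real (Prod.fst ⁻¹' p.2) ≤ n * (ζ * (2 * w)) := by
      gcongr; exact hvB.trans (by gcongr)
    linarith

/-! ### Union bound over the brackets. -/

section Core

variable {Ω : Type*} [MeasurableSpace Ω] {P : Measure Ω} [IsProbabilityMeasure P] {n d : ℕ}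
  {ν : Measure ((Fin d → ℝ) × ℝ)} {X : Fin n → Ω → (Fin d → ℝ)} {Y : Fin n → Ω → ℝ}

theorem measure_badEvent_le [IsProbabilityMeasure ν]
    (hlaw : ∀ i, HasLaw (fun ω => (X i ω, Y i ω)) ν P)
    (hindep : iIndepFun (fun i ω => (X i ω, Y i ω)) P) {M H w ε : ℝ} (hM : 0 ≤ M) (hH : 0 ≤ H)
    (hY : ∀ᵐ p ∂ν, |p.2| ≤ M) {p : Set (Fin d → ℝ) × Set (Fin d → ℝ)} (hp : IsBracket w ε p)
    (hpos : 0 < n * ν.real (Prod.fst ⁻¹' p.1))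
    (hpH : 4 * H ≤ n * ν.real (Prod.fst ⁻¹' p.1)) :
    P (badEvent ν X Y M H p) ≤ 5 * ENNReal.ofReal (Real.exp (-H)) := by
  have hfst : Measurable (Prod.fst : (Fin d → ℝ) × ℝ → Fin d → ℝ) := measurable_fst
  have m1 := hfst hp.measurableSet_fst
  have m2 := hfst hp.measurableSet_snd
  have m3 := hfst (hp.measurableSet_snd.diff hp.measurableSet_fst)
  have b1 := measure_count_lt_le hlaw hindep m1 hH hpos (by linarith)
  have b2 := measure_lt_abs_sum_indicator_le hlaw hindep m1 measurable_snd hM hY hH hpos hpH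
  have b3 := measure_lt_count_le hlaw hindep m3 H
  have b4 := measure_lt_count_le hlaw hindep m2 H
  simp only [sum_indicator_one_eq_count, sum_indicesIn] at b1 b2 b3 b4
  refine (measure_union_le _ _).trans ((add_le_add b1 ((measure_union_le _ _).trans
    (add_le_add b2 ((measure_union_le _ _).trans (add_le_add b3 b4))))).trans_eq ?_)
  ring

theorem measure_compl_le {ζ α M U : ℝ} {k Q : ℕ}
    (hn : 0 < n) (hd : 0 < d) (hζ : 1 ≤ ζ) (hα : 0 < α) (hα' : α < 1) (hk : 0 < k) (hkn : k ≤ n)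
    (hlaw : ∀ i, HasLaw (fun ω => (X i ω, Y i ω)) ν P)
    (hindep : iIndepFun (fun i ω => (X i ω, Y i ω)) P)
    (hM : 0 ≤ M) (hY : ∀ᵐ p ∂ν, |p.2| ≤ M) (hX : HasBoundedDensity ζ (ν.map Prod.fst))
    (hU : 100 * ζ ^ 4 ≤ U) (hUk : 9216 * ζ ^ 2 * U ≤ k)
    (hQ : (1 / 2 : ℝ) ^ (Q + 1) < (k : ℝ) / (8 * ζ * n)) {S m : ℕ}
    (hS : S = ⌊Real.log ((n : ℝ) / k) / Real.log ((1 - α)⁻¹)⌋₊) (hm : m = 24 * (S + 1) * k) :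
    P {ω | ∀ Λ ∈ validPartitions α k (fun i => X i ω), ∀ x ∈ unitCube d,
        |tree (fun i => X i ω) (fun i => Y i ω) Λ x - optimalTree ν Λ x| ≤
          9 * M * √U * (1 / √(k : ℝ))}ᶜ ≤
      ENNReal.ofReal (Real.exp 1 * (d * ((Q + 1) * (m * (m + 2)))) ^ S / ((k : ℝ) / (8 * ζ * n))
        * (5 * Real.exp (-(9 * U)))) := by
  have : IsProbabilityMeasure ν := (hlaw ⟨0, hn⟩).isProbabilityMeasure_iff.1 inferInstance
  have hζ0 : 0 < ζ := by linarith
  have hn' : (0 : ℝ) < n := by exact_mod_cast hn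
  have hk' : (0 : ℝ) < k := by exact_mod_cast hk
  have hU0 : 0 < U := by have : 0 < ζ ^ 4 := by positivity
                         linarith
  have hm8 : 8 * (S + 1) ≤ m := by rw [hm]; nlinarith
  have hm0 : (0 : ℝ) < m := by
    have : 0 < m := by omega
    exact_mod_cast this
  obtain ⟨R, hcard, hR, hRbox⟩ := exists_brackets hd hm8 (by positivity) hQ
  -- The factor `24 * (S + 1) * k` in `m` makes the relative bracket size at most `1 / k`, below the
  -- statistical error.
  have hε : 24 * S / (m : ℝ) ≤ 1 / k := by
    rw [div_le_div_iff₀ hm0 hk', hm]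
    push_cast
    nlinarith
  set N : Set Ω := {ω | ∀ i, |Y i ω| ≤ M}ᶜ with hN
  have hN0 : P N = 0 := by
    have : ∀ᵐ ω ∂P, ∀ i, |Y i ω| ≤ M := by
      rw [ae_all_iff]
      intro i
      have h := hY
      rw [← (hlaw i).map_eq] at h
      exact ae_of_ae_map (hlaw i).aemeasurable h
    exact this
  have hbad : ∀ p ∈ R, P (badEvent ν X Y M (9 * U) p) ≤
      5 * ENNReal.ofReal (Real.exp (-(9 * U))) := by
    intro p hpR
    have hp := hR p hpR
    have htk := hp.le_mul_measureReal hn hζ0 hX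
    set pA := ν.real (Prod.fst ⁻¹' p.1)
    have htH : 64 * (9 * U) ≤ n * pA := by
      have : ζ ^ 2 * (64 * (9 * U)) ≤ ζ ^ 2 * (n * pA) := by linarith
      exact le_of_mul_le_mul_left this (by positivity)
    exact measure_badEvent_le hlaw hindep hM (by positivity) hY hp (by linarith) (by linarith)
  calc P _ ≤ P (N ∪ ⋃ p ∈ R, badEvent ν X Y M (9 * U) p) := by
        refine measure_mono fun ω hω => ?_
        by_contra hcon
        simp only [hN, Set.mem_union, Set.mem_compl_iff, not_not, Set.mem_iUnion, not_or,
          not_exists] at hcon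
        refine hω fun Λ hΛ z hz => ?_
        refine abs_tree_sub_optimalTree_le hn hζ hk hkn hM hY hX hU hUk (by positivity) hε hR hRbox
          hcon.2 hcon.1 hΛ (fun L hL => ?_) hz
        rw [hS]
        exact exists_isNearBox_floor hα hα' hk hΛ hL
    _ ≤ P N + ∑ p ∈ R, P (badEvent ν X Y M (9 * U) p) :=
        (measure_union_le _ _).trans (by gcongr; exact measure_biUnion_finset_le _ _)
    _ ≤ 0 + ∑ _p ∈ R, 5 * ENNReal.ofReal (Real.exp (-(9 * U))) :=
        add_le_add hN0.le (Finset.sum_le_sum hbad)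
    _ = ENNReal.ofReal ((R.card : ℝ) * (5 * Real.exp (-(9 * U)))) := by
        rw [zero_add, Finset.sum_const, nsmul_eq_mul, ENNReal.ofReal_mul (by positivity),
          ENNReal.ofReal_mul (by positivity), ENNReal.ofReal_natCast]
        simp
    _ ≤ _ := by
        gcongr

end Core

/-! ### From finite samples to asymptotics. -/

/-- The events range over uncountably many partitions and need not be measurable; the complement of
a measurable hull of the failure set is the inner event. -/
theorem withHighProbability_of_tendsto_compl {Ω : ℕ → Type*} [∀ n, MeasurableSpace (Ω n)]
    {P : ∀ n, Measure (Ω n)} [∀ n, IsProbabilityMeasure (P n)] {E : ∀ n, Set (Ω n)}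
    (h : Tendsto (fun n => P n (E n)ᶜ) atTop (𝓝 0)) : WithHighProbability P E := by
  refine ⟨fun n => (toMeasurable (P n) (E n)ᶜ)ᶜ, fun n =>
    ⟨(measurableSet_toMeasurable _ _).compl, ?_⟩, ?_⟩
  · rw [Set.compl_subset_comm]; exact subset_toMeasurable _ _
  · have h1 : ∀ n, P n (toMeasurable (P n) (E n)ᶜ)ᶜ = 1 - P n (E n)ᶜ := fun n => by
      rw [prob_compl_eq_one_sub (measurableSet_toMeasurable _ _), measure_toMeasurable]
    simp_rw [h1]
    simpa using ENNReal.Tendsto.sub tendsto_const_nhds h (Or.inl ENNReal.one_ne_top)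

theorem half_pow_floor_logb_lt {x : ℝ} (hx : 1 ≤ x) :
    (1 / 2 : ℝ) ^ (⌊Real.logb 2 x⌋₊ + 1) < x⁻¹ := by
  have hx0 : 0 < x := by linarith
  rw [one_div, inv_pow, inv_lt_inv₀ (by positivity) hx0, ← Real.rpow_natCast]
  calc x = 2 ^ Real.logb 2 x := (Real.rpow_logb (by norm_num) (by norm_num) hx0).symm
    _ < _ := Real.rpow_lt_rpow_of_exponent_lt (by norm_num)
        (by push_cast; exact Nat.lt_floor_add_one _)

/-- The logarithm of the number of brackets is at most about
`log (n / k) / l * (log d + 2 log k + 3 log log n)`. -/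
theorem exists_entropy_le {ζ l : ℝ} (hζ : 1 ≤ ζ) (hl : 0 < l) :
    ∃ C : ℝ, 0 ≤ C ∧ ∀ n k d S Q m : ℕ, 3 ≤ n → 0 < k → k ≤ n → 0 < d →
      S = ⌊Real.log ((n : ℝ) / k) / l⌋₊ → Q = ⌊Real.logb 2 (8 * ζ * n / k)⌋₊ →
      m = 24 * (S + 1) * k →
      1 + S * Real.log (d * ((Q + 1) * (m * (m + 2)))) + Real.log (8 * ζ * n / k) ≤
        Real.log ((n : ℝ) / k) / l *
          (Real.log d + 2 * Real.log k + 3 * Real.log (Real.log n) + C) +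
        Real.log ((n : ℝ) / k) + C := by
  -- The constants serve `Q + 1 ≤ c₁ * log n` and `S + 1 ≤ c₂ * log n`. As `m` is of order `k * log
  -- n`, the code weight `(Q + 1) * m * (m + 2)` is at most `c₃ * (log n) ^ 3 * k ^ 2`, whence `3 *
  -- log log n` and `2 * log k`.
  set c₁ : ℝ := (Real.log (8 * ζ) + 1) / Real.log 2 + 1 with hc₁
  set c₂ : ℝ := 1 / l + 1 with hc₂
  set c₃ : ℝ := 1152 * c₁ * c₂ ^ 2 with hc₃
  have hlog2 : 0 < Real.log 2 := Real.log_pos (by norm_num)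
  have h8ζ : 0 ≤ Real.log (8 * ζ) := Real.log_nonneg (by linarith)
  have hc₁0 : 0 < c₁ := by positivity
  have hc₂0 : 0 < c₂ := by positivity
  have hc₃0 : 0 < c₃ := by positivity
  refine ⟨|Real.log c₃| + 1 + Real.log (8 * ζ), by positivity, ?_⟩
  intro n k d S Q m hn hk hkn hd hS hQ hm
  have hn' : (3 : ℝ) ≤ n := by exact_mod_cast hn
  have hk' : (1 : ℝ) ≤ k := by exact_mod_cast hk
  have hd' : (1 : ℝ) ≤ d := by exact_mod_cast hd
  have hkn' : (k : ℝ) ≤ n := by exact_mod_cast hkn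
  have hk0 : (0 : ℝ) < k := by linarith
  have hn0 : (0 : ℝ) < n := by linarith
  have hlogn : 1 ≤ Real.log n := by
    rw [Real.le_log_iff_exp_le hn0]
    linarith [Real.exp_one_lt_d9]
  have hlogk : 0 ≤ Real.log k := Real.log_nonneg hk'
  have hlogd : 0 ≤ Real.log d := Real.log_nonneg hd'
  have hloglog : 0 ≤ Real.log (Real.log n) := Real.log_nonneg hlogn
  have hnk : Real.log ((n : ℝ) / k) = Real.log n - Real.log k := Real.log_div hn0.ne' hk0.ne'
  have hnk0 : 0 ≤ Real.log ((n : ℝ) / k) := Real.log_nonneg ((one_le_div hk0).2 hkn')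
  have hbig : Real.log (8 * ζ * n / k) = Real.log (8 * ζ) + Real.log ((n : ℝ) / k) := by
    rw [mul_div_assoc, Real.log_mul (by positivity) (by positivity)]
  have hSD : (S : ℝ) ≤ Real.log ((n : ℝ) / k) / l := hS ▸ Nat.floor_le (by positivity)
  have hS1 : (S : ℝ) + 1 ≤ c₂ * Real.log n := by
    have : Real.log ((n : ℝ) / k) / l ≤ Real.log n / l := by
      rw [hnk]; gcongr; linarith
    rw [hc₂, add_mul, one_mul, one_div_mul_eq_div]
    linarith
  have hQ1 : (Q : ℝ) + 1 ≤ c₁ * Real.log n := by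
    have h1 : (Q : ℝ) ≤ Real.log (8 * ζ * n / k) / Real.log 2 := by
      rw [hQ, Real.log_div_log]
      refine Nat.floor_le ?_
      rw [← Real.log_div_log, hbig]
      positivity
    have h2 : Real.log (8 * ζ * n / k) / Real.log 2 ≤
        (Real.log (8 * ζ) + 1) * Real.log n / Real.log 2 := by
      gcongr
      rw [hbig]
      nlinarith
    rw [hc₁, add_mul, one_mul, div_mul_eq_mul_div]
    linarith
  have hm1 : (m : ℝ) ≤ 24 * (c₂ * Real.log n) * k := by
    rw [hm]; push_cast; gcongr
  have hm2 : (2 : ℝ) ≤ m := by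
    have : 2 ≤ m := by rw [hm]; nlinarith
    exact_mod_cast this
  have hK : (d : ℝ) * ((Q + 1) * (m * (m + 2))) ≤ d * (c₃ * Real.log n ^ 3 * k ^ 2) := by
    calc (d : ℝ) * ((Q + 1) * (m * (m + 2))) ≤ d * ((Q + 1) * (m * (2 * m))) := by
          gcongr; linarith
      _ ≤ d * ((c₁ * Real.log n) * ((24 * (c₂ * Real.log n) * k) *
          (2 * (24 * (c₂ * Real.log n) * k)))) := by gcongr
      _ = _ := by rw [hc₃]; ring
  have hlogK : Real.log ((d : ℝ) * ((Q + 1) * (m * (m + 2)))) ≤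
      Real.log d + 2 * Real.log k + 3 * Real.log (Real.log n) + |Real.log c₃| := by
    refine (Real.log_le_log (by positivity) hK).trans ?_
    have hln : Real.log n ≠ 0 := by linarith
    rw [Real.log_mul (by positivity) (by positivity), Real.log_mul (by positivity) (by positivity),
      Real.log_mul (by positivity) (by positivity), Real.log_pow, Real.log_pow]
    push_cast
    linarith [le_abs_self (Real.log c₃)]
  have h0 : 0 ≤ |Real.log c₃| := abs_nonneg _
  calc _ ≤ 1 + Real.log ((n : ℝ) / k) / l *
        (Real.log d + 2 * Real.log k + 3 * Real.log (Real.log n) + |Real.log c₃|) +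
        (Real.log (8 * ζ) + Real.log ((n : ℝ) / k)) := by
        rw [hbig]
        gcongr 1 + ?_ + _
        exact (mul_le_mul_of_nonneg_left hlogK (Nat.cast_nonneg S)).trans
          (mul_le_mul_of_nonneg_right hSD (by positivity))
    _ ≤ 1 + Real.log ((n : ℝ) / k) / l *
        (Real.log d + 2 * Real.log k + 3 * Real.log (Real.log n) +
          (|Real.log c₃| + 1 + Real.log (8 * ζ))) +
        (Real.log (8 * ζ) + Real.log ((n : ℝ) / k)) := by
        gcongr
        linarith
    _ ≤ _ := by linarith

section Asymptotics

variable {M ζ α : ℝ} {d k : ℕ → ℕ} {Ω : ℕ → Type*} [∀ n, MeasurableSpace (Ω n)]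
  {P : ∀ n, Measure (Ω n)} [∀ n, IsProbabilityMeasure (P n)]
  {ν : ∀ n, Measure ((Fin (d n) → ℝ) × ℝ)}
  {X : ∀ n, Fin n → Ω n → (Fin (d n) → ℝ)} {Y : ∀ n, Fin n → Ω n → ℝ}

/-- Both bounds are instances, with `U` the quantity under the square root. The constant `C` is
fixed before `U`, so the entropy condition can absorb it. -/
theorem withHighProbability_abs_tree_sub_le (hζ : 1 ≤ ζ) (hα : 0 < α) (hα' : α < 1)
    (hd : ∀ n, 0 < d n) (hk : ∀ n, 0 < k n)
    (hlaw : ∀ n i, HasLaw (fun ω => (X n i ω, Y n i ω)) (ν n) (P n))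
    (hindep : ∀ n, iIndepFun (fun i ω => (X n i ω, Y n i ω)) (P n))
    (hY : ∀ n, ∀ᵐ p ∂(ν n), p.2 ∈ Set.Icc (-M) M)
    (hX : ∀ n, HasBoundedDensity ζ ((ν n).map Prod.fst))
    {U : ℕ → ℝ} (hU : Tendsto U atTop atTop)
    (hUk : Tendsto (fun n => U n / k n) atTop (𝓝 0)) {C : ℝ}
    (hC : ∀ n k d S Q m : ℕ, 3 ≤ n → 0 < k → k ≤ n → 0 < d →
      S = ⌊Real.log ((n : ℝ) / k) / Real.log ((1 - α)⁻¹)⌋₊ →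
      Q = ⌊Real.logb 2 (8 * ζ * n / k)⌋₊ → m = 24 * (S + 1) * k →
      1 + S * Real.log (d * ((Q + 1) * (m * (m + 2)))) + Real.log (8 * ζ * n / k) ≤
        Real.log ((n : ℝ) / k) / Real.log ((1 - α)⁻¹) *
          (Real.log d + 2 * Real.log k + 3 * Real.log (Real.log n) + C) +
        Real.log ((n : ℝ) / k) + C)
    (hent : ∀ᶠ n : ℕ in atTop, k n ≤ n → Real.log ((n : ℝ) / k n) / Real.log ((1 - α)⁻¹) *
          (Real.log (d n) + 2 * Real.log (k n) + 3 * Real.log (Real.log n) + C) +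
        Real.log ((n : ℝ) / k n) + C ≤ 5 * U n) :
    WithHighProbability P (fun n => {ω | ∀ Λ ∈ validPartitions α (k n) (fun i => X n i ω),
      ∀ x ∈ unitCube (d n),
        |tree (fun i => X n i ω) (fun i => Y n i ω) Λ x - optimalTree (ν n) Λ x| ≤
          9 * M * √(U n) * (1 / √(k n : ℝ))}) := by
  refine withHighProbability_of_tendsto_compl ?_
  have hlim : Tendsto (fun n => ENNReal.ofReal (5 * Real.exp (-(4 * U n)))) atTop (𝓝 0) := by
    have h1 : Tendsto (fun n => 5 * Real.exp (-(4 * U n))) atTop (𝓝 (5 * 0)) :=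
      (Real.tendsto_exp_neg_atTop_nhds_zero.comp (hU.const_mul_atTop (by norm_num))).const_mul 5
    simpa using ENNReal.tendsto_ofReal h1
  refine tendsto_of_tendsto_of_tendsto_of_le_of_le' tendsto_const_nhds hlim
    (Eventually.of_forall fun n => zero_le) ?_
  have hζ2 : 0 < 9216 * ζ ^ 2 := by positivity
  filter_upwards [hent, eventually_ge_atTop 3, hU.eventually_ge_atTop (100 * ζ ^ 4),
    hUk.eventually (eventually_le_nhds (inv_pos.2 hζ2))] with n hentn hn3 hUn hUkn
  -- If `k n > n` there is no valid partition and the event is everything; the second bound needs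
  -- this, as it does not restrict `k`.
  rcases lt_or_ge n (k n) with hlt | hkn
  · refine le_of_eq_of_le ?_ (zero_le)
    convert measure_empty (μ := P n)
    rw [Set.compl_empty_iff, Set.eq_univ_iff_forall]
    intro ω Λ hΛ z hz
    obtain ⟨L, ⟨hL, -⟩, -⟩ := hΛ.1.existsUnique.2 z hz
    exact absurd ((hΛ.2 L hL).trans (count_le _ _)) (not_le.2 hlt)
  have hn : 0 < n := by omega
  have : IsProbabilityMeasure (ν n) :=
    (hlaw n ⟨0, hn⟩).isProbabilityMeasure_iff.1 inferInstance
  have hYn : ∀ᵐ p ∂(ν n), |p.2| ≤ M := by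
    filter_upwards [hY n] with p hp using abs_le.2 hp
  have hM : 0 ≤ M := by
    obtain ⟨p, hp⟩ := hYn.exists
    exact (abs_nonneg _).trans hp
  have hn' : (0 : ℝ) < n := by exact_mod_cast hn
  have hk' : (0 : ℝ) < k n := by exact_mod_cast hk n
  have hkn' : (k n : ℝ) ≤ n := by exact_mod_cast hkn
  have hd' : (0 : ℝ) < d n := by exact_mod_cast hd n
  have hx : 1 ≤ 8 * ζ * n / k n := by
    rw [one_le_div hk']; nlinarith
  have hQ := half_pow_floor_logb_lt hx
  rw [inv_div] at hQ
  have hUk' : 9216 * ζ ^ 2 * U n ≤ k n := by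
    rw [div_le_iff₀ hk', ← div_eq_inv_mul, le_div_iff₀ hζ2] at hUkn
    linarith
  refine (measure_compl_le hn (hd n) hζ hα hα' (hk n) hkn (hlaw n) (hindep n) hM hYn (hX n) hUn
    hUk' hQ rfl rfl).trans (ENNReal.ofReal_le_ofReal ?_)
  have hCn := (hC n (k n) (d n) _ _ _ hn3 (hk n) hkn (hd n) rfl rfl rfl).trans (hentn hkn)
  set S := ⌊Real.log ((n : ℝ) / k n) / Real.log ((1 - α)⁻¹)⌋₊
  set Q := ⌊Real.logb 2 (8 * ζ * n / k n)⌋₊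
  set m : ℕ := 24 * (S + 1) * k n with hm
  have hm0 : (0 : ℝ) < m := by
    have : 0 < m := by have := hk n; positivity
    exact_mod_cast this
  set K : ℝ := d n * ((Q + 1) * (m * (m + 2)))
  have hK : 0 < K := by positivity
  have hx0 : 0 < 8 * ζ * n / k n := by linarith
  have e : Real.exp 1 * K ^ S / ((k n : ℝ) / (8 * ζ * n)) =
      Real.exp (1 + S * Real.log K + Real.log (8 * ζ * n / k n)) := by
    rw [Real.exp_add, Real.exp_add, Real.exp_nat_mul, Real.exp_log hK, Real.exp_log hx0,
      div_eq_mul_inv, inv_div]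
  calc _ ≤ Real.exp (5 * U n) * (5 * Real.exp (-(9 * U n))) := by
        rw [e]; gcongr
    _ = 5 * Real.exp (-(4 * U n)) := by
        rw [mul_left_comm, ← Real.exp_add]; ring_nf

end Asymptotics

/-- The scaling assumption does not mention `log k`. If `k ≤ (log n) ^ 4`, then `log k` is at most
`4 * log log n`; otherwise `log k ≤ 2 * √k` and `k` itself beats `(log n) ^ 2`. -/
theorem log_mul_log_div_le {n k : ℝ} (hn : 1 < Real.log n) (hk : 1 ≤ k) :
    Real.log n * Real.log k / k ≤
      4 * (Real.log n * Real.log (Real.log n) / k) + 2 / Real.log n := by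
  have hk0 : 0 < k := by linarith
  have hn0 : 0 < Real.log n := by linarith
  have hll : 0 < Real.log (Real.log n) := Real.log_pos hn
  rcases le_total k (Real.log n ^ 4) with h | h
  · have h1 : Real.log k ≤ 4 * Real.log (Real.log n) := by
      have := Real.log_le_log hk0 h
      rw [Real.log_pow] at this
      exact_mod_cast this
    have h2 : Real.log n * Real.log k / k ≤ 4 * (Real.log n * Real.log (Real.log n) / k) := by
      rw [mul_div_assoc', div_le_div_iff_of_pos_right hk0]
      nlinarith
    have : 0 ≤ 2 / Real.log n := by positivity
    linarith
  · have h1 : Real.log k ≤ 2 * √k := by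
      have h3 := Real.log_le_self (Real.sqrt_nonneg k)
      rw [Real.log_sqrt hk0.le] at h3
      linarith
    have h2 : Real.log n ^ 2 ≤ √k := Real.le_sqrt_of_sq_le (by rw [← pow_mul]; exact h)
    have hs : 0 < √k := Real.sqrt_pos.2 hk0
    have h4 : Real.log n * Real.log k / k ≤ 2 / Real.log n := by
      rw [div_le_div_iff₀ hk0 hn0]
      calc Real.log n * Real.log k * Real.log n = Real.log n ^ 2 * Real.log k := by ring
        _ ≤ √k * (2 * √k) := by
            have := Real.log_nonneg hk
            gcongr
        _ = 2 * k := by rw [mul_left_comm, Real.mul_self_sqrt hk0.le]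
    have : 0 ≤ 4 * (Real.log n * Real.log (Real.log n) / k) := by positivity
    linarith

theorem tendsto_log_log : Tendsto (fun n : ℕ => Real.log (Real.log n)) atTop atTop :=
  Real.tendsto_log_atTop.comp (Real.tendsto_log_atTop.comp tendsto_natCast_atTop_atTop)

theorem eventually_le_log_div {k : ℕ → ℕ} (hk : ∀ n, 0 < k n)
    (h : limsup (fun n : ℕ => (k n : ℝ≥0∞) / (n : ℝ≥0∞)) atTop < 1) :
    ∃ c : ℝ, 0 < c ∧ ∀ᶠ n : ℕ in atTop, k n ≤ n ∧ c ≤ Real.log ((n : ℝ) / k n) := by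
  obtain ⟨c, hc1, hc2⟩ := exists_between h
  lift c to NNReal using (hc2.trans ENNReal.one_lt_top).ne
  have hev := eventually_lt_of_limsup_lt hc1
  have hc2' : (c : ℝ) < 1 := by exact_mod_cast hc2
  have hev' : ∀ᶠ n : ℕ in atTop, (k n : ℝ) < c * n := by
    filter_upwards [hev, eventually_gt_atTop 0] with n hn hn0
    rw [ENNReal.div_lt_iff (Or.inl (by exact_mod_cast hn0.ne'))
      (Or.inl (ENNReal.natCast_ne_top n))] at hn
    exact_mod_cast hn
  have hc0 : (0 : ℝ) < c := by
    obtain ⟨n, hn⟩ := hev'.exists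
    have h1 : (0 : ℝ) < c * n := lt_trans (by exact_mod_cast hk n) hn
    exact pos_of_mul_pos_left h1 (Nat.cast_nonneg n)
  refine ⟨Real.log (c : ℝ)⁻¹, Real.log_pos ((one_lt_inv₀ hc0).2 hc2'), ?_⟩
  filter_upwards [hev'] with n hn
  have hk0 : (0 : ℝ) < k n := by exact_mod_cast hk n
  refine ⟨?_, ?_⟩
  · have : (k n : ℝ) ≤ n := hn.le.trans (mul_le_of_le_one_left (Nat.cast_nonneg n) hc2'.le)
    exact_mod_cast this
  · refine Real.log_le_log (by positivity) ?_
    rw [le_div_iff₀ hk0, inv_mul_le_iff₀ hc0]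
    exact hn.le

theorem eventually_log_le_log_add {d : ℕ → ℕ}
    (h : 0 < liminf (fun n : ℕ => (d n : ℝ≥0∞) / (n : ℝ≥0∞)) atTop) :
    ∃ c : ℝ, ∀ᶠ n : ℕ in atTop, Real.log n ≤ Real.log (d n) + c := by
  obtain ⟨c, hc1, hc2⟩ := exists_between h
  lift c to NNReal using (hc2.trans_le le_top).ne
  have hev := eventually_lt_of_lt_liminf hc2
  have hc0 : (0 : ℝ) < c := by exact_mod_cast hc1
  refine ⟨-Real.log c, ?_⟩
  filter_upwards [hev, eventually_gt_atTop 0] with n hn hn0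
  rw [ENNReal.lt_div_iff_mul_lt (Or.inl (by exact_mod_cast hn0.ne'))
      (Or.inl (ENNReal.natCast_ne_top n))] at hn
  have hn' : (c : ℝ) * n < d n := by exact_mod_cast hn
  have hnpos : (0 : ℝ) < n := by exact_mod_cast hn0
  have := Real.log_le_log (by positivity) hn'.le
  rw [Real.log_mul hc0.ne' hnpos.ne'] at this
  linarith

end TreeConcentration

/-! ### The two bounds. -/

theorem mainTheorem1
    (M ζ α : ℝ) (hζ : 1 ≤ ζ) (hα : 0 < α) (hα' : α < 1 / 2)
    (d k : ℕ → ℕ) (hd : ∀ n, 0 < d n) (hk : ∀ n, 0 < k n)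
    -- the data: for each `n`, an i.i.d. sample of size `n` from a distribution `ν n`
    {Ω : ℕ → Type*} [∀ n, MeasurableSpace (Ω n)]
    (P : ∀ n, Measure (Ω n)) [∀ n, IsProbabilityMeasure (P n)]
    (ν : ∀ n, Measure ((Fin (d n) → ℝ) × ℝ))
    (X : ∀ n, Fin n → Ω n → (Fin (d n) → ℝ)) (Y : ∀ n, Fin n → Ω n → ℝ)
    (hlaw : ∀ n i, HasLaw (fun ω => (X n i ω, Y n i ω)) (ν n) (P n))
    (hindep : ∀ n, iIndepFun (fun i ω => (X n i ω, Y n i ω)) (P n))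
    -- bounded responses, and features with a density bounded below and above
    (hY : ∀ n, ∀ᵐ p ∂(ν n), p.2 ∈ Set.Icc (-M) M)
    (hX : ∀ n, TreeConcentration.HasBoundedDensity ζ ((ν n).map Prod.fst))
    -- the minimum leaf size grows fast enough
    (hscale : Tendsto (fun n : ℕ =>
      Real.log n * max (Real.log (d n)) (Real.log (Real.log n)) / (k n : ℝ)) atTop (𝓝 0)) :
    -- first bound
    (limsup (fun n : ℕ => (k n : ℝ≥0∞) / (n : ℝ≥0∞)) atTop < 1 →
      TreeConcentration.WithHighProbability P (fun n => {ω |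
        ∀ Λ ∈ TreeConcentration.validPartitions α (k n) (fun i => X n i ω),
        ∀ x ∈ TreeConcentration.unitCube (d n),
          |TreeConcentration.tree (fun i => X n i ω) (fun i => Y n i ω) Λ x
              - TreeConcentration.optimalTree (ν n) Λ x|
            ≤ 9 * M * √(Real.log ((n : ℝ) / (k n : ℝ))
                * (Real.log ((d n : ℝ) * (k n : ℝ)) + 3 * Real.log (Real.log n))
                / Real.log ((1 - α)⁻¹)) * (1 / √(k n : ℝ))})) ∧
    -- second bound
    (0 < liminf (fun n : ℕ => (d n : ℝ≥0∞) / (n : ℝ≥0∞)) atTop →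
      TreeConcentration.WithHighProbability P (fun n => {ω |
        ∀ Λ ∈ TreeConcentration.validPartitions α (k n) (fun i => X n i ω),
        ∀ x ∈ TreeConcentration.unitCube (d n),
          |TreeConcentration.tree (fun i => X n i ω) (fun i => Y n i ω) Λ x
              - TreeConcentration.optimalTree (ν n) Λ x|
            ≤ 9 * M * √(Real.log n * Real.log (d n) / Real.log ((1 - α)⁻¹))
                * (1 / √(k n : ℝ))})) := by
  have hα1 : α < 1 := by linarith
  set l := Real.log ((1 - α)⁻¹) with hl_def
  have hl : 0 < l := Real.log_pos ((one_lt_inv₀ (by linarith)).2 (by linarith))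
  obtain ⟨C, hC0, hC⟩ := TreeConcentration.exists_entropy_le hζ hl
  have hlog : Tendsto (fun n : ℕ => Real.log n) atTop atTop :=
    Real.tendsto_log_atTop.comp tendsto_natCast_atTop_atTop
  have hd' : ∀ n, 0 ≤ Real.log (d n) := fun n =>
    Real.log_nonneg (by exact_mod_cast hd n)
  have hk1 : ∀ n, (1 : ℝ) ≤ k n := fun n => by exact_mod_cast hk n
  have hk' : ∀ n, 0 ≤ Real.log (k n) := fun n => Real.log_nonneg (hk1 n)
  set g : ℕ → ℝ := fun n =>
    Real.log n * max (Real.log (d n)) (Real.log (Real.log n)) / (k n : ℝ) with hg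
  refine ⟨fun hlim => ?_, fun hlim => ?_⟩
  · obtain ⟨c, hc0, hc⟩ := TreeConcentration.eventually_le_log_div hk hlim
    set T : ℕ → ℝ := fun n => Real.log ((d n : ℝ) * (k n : ℝ)) + 3 * Real.log (Real.log n) with hT
    have hdk : ∀ n, Real.log ((d n : ℝ) * (k n : ℝ)) = Real.log (d n) + Real.log (k n) := fun n =>
      Real.log_mul (by exact_mod_cast (hd n).ne') (by exact_mod_cast (hk n).ne')
    have hTlim : Tendsto T atTop atTop := by
      refine tendsto_atTop_mono (fun n => ?_)
        (TreeConcentration.tendsto_log_log.const_mul_atTop (by norm_num : (0 : ℝ) < 3))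
      have := hd' n
      have := hk' n
      simp only [hT, hdk]
      linarith
    -- Here `limsup k / n < 1` is used: it keeps `log (n / k)` away from zero, so that the failure
    -- probability vanishes.
    have hU : Tendsto (fun n : ℕ => Real.log ((n : ℝ) / (k n : ℝ)) * T n / l) atTop atTop := by
      refine tendsto_atTop_mono' _ ?_ (hTlim.const_mul_atTop (div_pos hc0 hl))
      filter_upwards [hc, hTlim.eventually_ge_atTop 0] with n hn hTn
      rw [div_mul_eq_mul_div]
      gcongr
      exact hn.2
    refine TreeConcentration.withHighProbability_abs_tree_sub_le hζ hα hα1 hd hk hlaw hindep hY hX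
      hU ?_ hC ?_
    · have hup : Tendsto (fun n : ℕ => (8 * g n + 2 / Real.log n) / l) atTop (𝓝 0) := by
        simpa using ((hscale.const_mul 8).add (hlog.const_div_atTop 2)).div_const l
      refine tendsto_of_tendsto_of_tendsto_of_le_of_le' tendsto_const_nhds hup ?_ ?_
      · filter_upwards [hU.eventually_ge_atTop 0] with n hn
        positivity
      · filter_upwards [hc, hTlim.eventually_ge_atTop 0, hlog.eventually_gt_atTop 1,
          eventually_gt_atTop 0] with n hn hTn hlogn hn0
        have hk0 : (0 : ℝ) < k n := by linarith [hk1 n]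
        have hn0' : (0 : ℝ) < n := by exact_mod_cast hn0
        have h1 := TreeConcentration.log_mul_log_div_le hlogn (hk1 n)
        have h2 : Real.log n * Real.log (d n) / k n ≤ g n := by
          simp only [hg]; gcongr; exact le_max_left _ _
        have h3 : Real.log n * Real.log (Real.log n) / k n ≤ g n := by
          simp only [hg]; gcongr; exact le_max_right _ _
        have h4 : Real.log ((n : ℝ) / k n) ≤ Real.log n := by
          rw [Real.log_div hn0'.ne' hk0.ne']; linarith [hk' n]
        rw [div_right_comm]
        gcongr
        calc Real.log ((n : ℝ) / k n) * T n / k n ≤ Real.log n * T n / k n := by gcongr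
          _ = Real.log n * Real.log (d n) / k n + Real.log n * Real.log (k n) / k n +
              3 * (Real.log n * Real.log (Real.log n) / k n) := by
              simp only [hT, hdk]; ring
          _ ≤ _ := by linarith
    · filter_upwards [hc, hTlim.eventually_ge_atTop (C + l), hU.eventually_ge_atTop C,
        TreeConcentration.tendsto_log_log.eventually_ge_atTop 0] with n hn hTn hUn hll _
      set D := Real.log ((n : ℝ) / k n) with hD
      have hD0 : 0 ≤ D := hc0.le.trans hn.2
      have e : D = D / l * l := by field_simp
      have hDl : 0 ≤ D / l := by positivity
      have e2 : D * T n / l = D / l * T n := by ring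
      rw [e2] at hUn ⊢
      -- The entropy has `2 * log k` where `T` has `log k`. This factor 2 and one more `T` for the
      -- constants give `3 * U`; the last `C` costs another `U`, within the allowed `5 * U`.
      have hkT : Real.log (d n) + 2 * Real.log (k n) + 3 * Real.log (Real.log n) ≤ 2 * T n := by
        simp only [hT, hdk]; linarith [hd' n]
      calc D / l * (Real.log (d n) + 2 * Real.log (k n) + 3 * Real.log (Real.log n) + C) + D + C
          = D / l * (Real.log (d n) + 2 * Real.log (k n) + 3 * Real.log (Real.log n) + (C + l))
              + C := by
            linear_combination e
        _ ≤ D / l * (2 * T n + T n) + D / l * T n := by gcongr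
        _ ≤ _ := by
            have : 0 ≤ D / l * T n := by linarith
            linarith
  · obtain ⟨c, hc⟩ := TreeConcentration.eventually_log_le_log_add hlim
    have hdlim : Tendsto (fun n => Real.log (d n)) atTop atTop := by
      refine tendsto_atTop_mono' _ ?_ (tendsto_atTop_add_const_right _ (-c) hlog)
      filter_upwards [hc] with n hn
      linarith
    have hU : Tendsto (fun n : ℕ => Real.log n * Real.log (d n) / l) atTop atTop :=
      (hlog.atTop_mul_atTop₀ hdlim).atTop_div_const hl
    refine TreeConcentration.withHighProbability_abs_tree_sub_le hζ hα hα1 hd hk hlaw hindep hY hX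
      hU ?_ hC ?_
    · have hup : Tendsto (fun n : ℕ => g n / l) atTop (𝓝 0) := by
        simpa using hscale.div_const l
      refine tendsto_of_tendsto_of_tendsto_of_le_of_le' tendsto_const_nhds hup ?_ ?_
      · filter_upwards [hU.eventually_ge_atTop 0] with n hn
        positivity
      · filter_upwards [hlog.eventually_ge_atTop 0] with n hn
        have hk0 : (0 : ℝ) < k n := by linarith [hk1 n]
        rw [div_right_comm]
        simp only [hg]
        gcongr
        exact le_max_left _ _
    -- As `log k ≤ log n ≤ log d + c`, the entropy factor is at most `log d + 3 * log n - 3 * c ≤ 4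
    -- * log d` once the `log log n` term and the constants fit into one `log n`.
    · have hsmall : ∀ᶠ n : ℕ in atTop,
          3 * Real.log (Real.log n) + (3 * c + C + l) ≤ Real.log n := by
        have h1 : Tendsto (fun x : ℝ => x - 3 * Real.log x) atTop atTop := by
          have h2 : (fun x : ℝ => 3 * Real.log x) =o[atTop] (fun x : ℝ => x) :=
            Real.isLittleO_log_id_atTop.const_mul_left 3
          have h3 := (Asymptotics.IsEquivalent.refl (u := fun x : ℝ => x)
            (l := atTop)).sub_isLittleO h2
          exact h3.symm.tendsto_atTop tendsto_id
        filter_upwards [(h1.comp hlog).eventually_ge_atTop (3 * c + C + l)] with n hn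
        simp only [Function.comp_apply] at hn
        linarith
      filter_upwards [hc, hsmall, hU.eventually_ge_atTop C, hlog.eventually_ge_atTop 0,
        TreeConcentration.tendsto_log_log.eventually_ge_atTop 0, eventually_gt_atTop 0]
        with n hcn hsn hUn hlogn hll hn0 hkn
      have hk0 : (0 : ℝ) < k n := by linarith [hk1 n]
      have hn0' : (0 : ℝ) < n := by exact_mod_cast hn0
      have hkn' : Real.log (k n) ≤ Real.log n := Real.log_le_log hk0 (by exact_mod_cast hkn)
      have h4 : Real.log ((n : ℝ) / k n) ≤ Real.log n := by
        rw [Real.log_div hn0'.ne' hk0.ne']; linarith [hk' n]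
      have hd0 := hd' n
      have hk0' := hk' n
      have e : Real.log n = Real.log n / l * l := by field_simp
      calc _ ≤ Real.log n / l *
            (Real.log (d n) + 2 * Real.log (k n) + 3 * Real.log (Real.log n) + C) +
            Real.log n + C := by gcongr
        _ = Real.log n / l *
            (Real.log (d n) + 2 * Real.log (k n) + 3 * Real.log (Real.log n) + (C + l)) + C := by
            linear_combination e
        _ ≤ Real.log n / l * (4 * Real.log (d n)) + Real.log n * Real.log (d n) / l := by
            gcongr
            linarith
        _ = _ := by ring
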